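/- Let $\mathcal X,\mathcal Y$ be measurable spaces, $\mathcal H$ a class of measurable functions $\mathcal X\to\mathcal Y$, and $\ell:\mathcal Y\times\mathcal Y\to[0,1]$ a measurable loss. For a probability distribution $D$ on $\mathcal X\times\mathcal Y$ put $L_D(h)=\mathbb E_{(x,y)\sim D}\,\ell(h(x),y)$, and call $D$ realizable if $L_D(h)=0$ for some $h\in\mathcal H$. A learner $A$ is a (possibly randomized, jointly measurable) map from finite samples in $\mathcal X\times\mathcal Y$ to predictors $\mathcal X\to\mathcal Y$. For $S=(x_1,\dots,x_n)\in\mathcal X^n$ and $h\in\mathcal H$, the transductive error $L^{\mathrm{Trans}}_{S,h}(A)$ is $\frac1n\sum_{i=1}^n\mathbb E\,\ell\big(A((x_j,h(x_j))_{j\ne i})(x_i),h(x_i)\big)$ (it is $0$ for $n=0$). Define, with values in $\mathbb N\cup\{\infty\}$ and with the minimum taken over all learners $A$: - $m_{\mathrm{PAC}}(\epsilon,\delta)=\min_A$ of the least $m$ such that for all $m'\ge m$ and all realizable $D$, with probability at least $1-\delta$ over $S\sim D^{m'}$ and the randomness of $A$, $L_D(A(S))\le\inf_{h\in\mathcal H}L_D(h)+\epsilon$;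 - $m_{\mathrm{Exp}}(\epsilon)=\min_A$ of the least $m$ such that $\mathbb E_{S\sim D^{m'}}L_D(A(S))\le\epsilon$ for all $m'\ge m$ and all realizable $D$ (the expectation includes the randomness of $A$); - $m_{\mathrm{Trans}}(\epsilon)=\min_A$ of the least $m$ such that $\sup_{S\in\mathcal X^{m'},\,h\in\mathcal H}L^{\mathrm{Trans}}_{S,h}(A)<\epsilon$ for all $m'\ge m$. Then: 1. For all $\epsilon,\delta\in(0,1)$, $m_{\mathrm{Exp}}(\epsilon+\delta)\le m_{\mathrm{PAC}}(\epsilon,\delta)$. Moreover $m_{\mathrm{PAC}}(\epsilon,\delta)=O\big(m_{\mathrm{Exp}}(\epsilon/2)\cdot\log(1/\min\{\epsilon,\delta\})\big)$ as $\epsilon\to0$: there are $K>0$ and $\epsilon_0\in(0,1)$, depending only on $(\mathcal X,\mathcal Y,\mathcal H,\ell)$, such that $$m_{\mathrm{PAC}}(\epsilon,\delta)\le K\,m_{\mathrm{Exp}}(\epsilon/2)\,\log\frac1{\min\{\epsilon,\delta\}}\qquad\text{for all }\epsilon\in(0,\epsilon_0),\ \delta\in(0,1);$$ in particular the factor is $\log(1/\epsilon)$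 whenever $\delta\ge\epsilon$. With an absolute constant $C$, independent of $(\mathcal X,\mathcal Y,\mathcal H,\ell)$, one has $m_{\mathrm{PAC}}(\epsilon,\delta)\le C\max\{m_{\mathrm{Exp}}(\epsilon/2),1/\epsilon\}\log(1/\min\{\epsilon,\delta\})$ for all $\epsilon\in(0,1/2]$, $\delta\in(0,1)$. 2. For all $\epsilon\in(0,1)$: $m_{\mathrm{Exp}}(\epsilon)\le m_{\mathrm{Trans}}(\epsilon)$, provided $\ell(y,y')=0$ only if $y=y'$; and $m_{\mathrm{Trans}}(\epsilon)\le m_{\mathrm{Exp}}(\epsilon/e)+1$, provided $\ell(y,y)=0$ for all $y$. (The $+1$ reflects that $m_{\mathrm{Trans}}$ counts the test point and $m_{\mathrm{Exp}}$ counts training points only.) 3. For every $n\ge1$ there is $m_n\in\mathbb N$ such that $m_n$ independent uniform draws from $n$ items show exactly $n-1$ distinct items with probability at least $1/e$. -/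

import Mathlib

open MeasureTheory
open scoped ENNReal

universe u v

/-- A (possibly randomized) learning rule for training samples of size `n`: it draws an internal
random seed from an arbitrary probability space and outputs a predictor `X → Y`. -/
structure LearningRule (X : Type u) (Y : Type v) [MeasurableSpace X] [MeasurableSpace Y]
    (n : ℕ) where
  /-- The space of seeds. -/
  Seed : Type
  /-- Its measurable structure. -/
  [measurableSpaceSeed : MeasurableSpace Seed]
  /-- The law of the seed. -/
  seedLaw : Measure Seed
  [isProbabilityMeasure_seedLaw : IsProbabilityMeasure seedLaw]
  /-- `predict ω S` is the predictor output on the training sample `S` with seed `ω`. -/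
  predict : Seed → (Fin n → X × Y) → X → Y
  measurable_predict :
    Measurable (fun p : Seed × (Fin n → X × Y) × X => predict p.1 p.2.1 p.2.2)

attribute [instance] LearningRule.measurableSpaceSeed LearningRule.isProbabilityMeasure_seedLaw

/-- A learner: a (possibly randomized) map from training samples of all finite sizes to
predictors. -/
abbrev Learner (X : Type u) (Y : Type v) [MeasurableSpace X] [MeasurableSpace Y] :=
  (n : ℕ) → LearningRule X Y n

noncomputable section

/-- The true error `L_D(h)` of the predictor `h` under the distribution `D`. -/
def trueError {X : Type u} {Y : Type v} [MeasurableSpace X] [MeasurableSpace Y]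
    (ℓ : Y → Y → ℝ) (D : ProbabilityMeasure (X × Y)) (h : X → Y) : ℝ≥0∞ :=
  ∫⁻ z, ENNReal.ofReal (ℓ (h z.1) z.2) ∂(D : Measure (X × Y))

/-- The distributions `D` such that `L_D(h) = 0` for some `h ∈ H`. -/
def realizable {X : Type u} {Y : Type v} [MeasurableSpace X] [MeasurableSpace Y]
    (ℓ : Y → Y → ℝ) (H : Set (X → Y)) : Set (ProbabilityMeasure (X × Y)) :=
  {D | ∃ h ∈ H, trueError ℓ D h = 0}

/-- The joint law of the seed of the rule `R` and of an independent i.i.d. sample of size `n`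
from `D`. -/
def runLaw {X : Type u} {Y : Type v} [MeasurableSpace X] [MeasurableSpace Y] {n : ℕ}
    (R : LearningRule X Y n) (D : ProbabilityMeasure (X × Y)) :
    Measure (R.Seed × (Fin n → X × Y)) :=
  R.seedLaw.prod (Measure.pi fun _ : Fin n => (D : Measure (X × Y)))

/-- The expected true error of the output of the rule `R` on an i.i.d. sample from `D`. -/
def expectedError {X : Type u} {Y : Type v} [MeasurableSpace X] [MeasurableSpace Y] {n : ℕ}
    (ℓ : Y → Y → ℝ) (R : LearningRule X Y n) (D : ProbabilityMeasure (X × Y)) : ℝ≥0∞ :=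
  ∫⁻ p, trueError ℓ D (R.predict p.1 p.2) ∂(runLaw R D)

/-- The probability that the output of the rule `R` on an i.i.d. sample from `D` has error
exceeding the best error in `H` by more than `ε`. -/
def failureProb {X : Type u} {Y : Type v} [MeasurableSpace X] [MeasurableSpace Y] {n : ℕ}
    (ℓ : Y → Y → ℝ) (H : Set (X → Y)) (R : LearningRule X Y n)
    (D : ProbabilityMeasure (X × Y)) (ε : ℝ) : ℝ≥0∞ :=
  runLaw R D {p | ¬ trueError ℓ D (R.predict p.1 p.2) ≤
    (⨅ h ∈ H, trueError ℓ D h) + ENNReal.ofReal ε}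

/-- The transductive error of `A` on `n` unlabeled points `S` and a hypothesis `h`: the error at
a uniformly random point of `S` after training on the other `n - 1` points labeled by `h`,
averaged also over the internal randomness of `A`. On no points it is `0`. -/
def transError {X : Type u} {Y : Type v} [MeasurableSpace X] [MeasurableSpace Y]
    (ℓ : Y → Y → ℝ) (A : Learner X Y) : (n : ℕ) → (Fin n → X) → (X → Y) → ℝ≥0∞
  | 0, _, _ => 0
  | k + 1, S, h =>
    (∑ i : Fin (k + 1), ∫⁻ ω, ENNReal.ofReal
      (ℓ ((A k).predict ω (fun j => (S (i.succAbove j), h (S (i.succAbove j)))) (S i)) (h (S i)))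
      ∂(A k).seedLaw) / ((k + 1 : ℕ) : ℝ≥0∞)

/-- The transductive error rate of `A` for `H` on `n` points. -/
def transRate {X : Type u} {Y : Type v} [MeasurableSpace X] [MeasurableSpace Y]
    (ℓ : Y → Y → ℝ) (H : Set (X → Y)) (A : Learner X Y) (n : ℕ) : ℝ≥0∞ :=
  ⨆ S : Fin n → X, ⨆ h ∈ H, transError ℓ A n S h

/-- The least `m` such that `good m'` for all `m' ≥ m`; it is `⊤` if there is none. -/
def threshold (good : ℕ → Prop) : ℕ∞ :=
  ⨅ (m : ℕ) (_ : ∀ m' ≥ m, good m'), (m : ℕ∞)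

/-- The sample complexity of `H` in the realizable PAC framework, the optimum over all
learners. -/
def mPAC {X : Type u} {Y : Type v} [MeasurableSpace X] [MeasurableSpace Y]
    (ℓ : Y → Y → ℝ) (H : Set (X → Y)) (ε δ : ℝ) : ℕ∞ :=
  ⨅ A : Learner X Y, threshold fun m =>
    ∀ D ∈ realizable ℓ H, failureProb ℓ H (A m) D ε ≤ ENNReal.ofReal δ

/-- The sample complexity of `H` in the realizable expected error framework, the optimum over all
learners. -/
def mExp {X : Type u} {Y : Type v} [MeasurableSpace X] [MeasurableSpace Y]
    (ℓ : Y → Y → ℝ) (H : Set (X → Y)) (ε : ℝ) : ℕ∞ :=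
  ⨅ A : Learner X Y, threshold fun m =>
    ∀ D ∈ realizable ℓ H, expectedError ℓ (A m) D ≤ ENNReal.ofReal ε

/-- The transductive sample complexity of `H`, the optimum over all learners; it counts all
points of an instance, the test point included. -/
def mTrans {X : Type u} {Y : Type v} [MeasurableSpace X] [MeasurableSpace Y]
    (ℓ : Y → Y → ℝ) (H : Set (X → Y)) (ε : ℝ) : ℕ∞ :=
  ⨅ A : Learner X Y, threshold fun m => transRate ℓ H A m < ENNReal.ofReal ε

end

/-!
The two expected-error inequalities are averaging arguments. A PAC learner errs by more than `ε`
with probability at most `δ`, and the loss is at most one, so its expected error is at most `ε + δ`.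
For `mExp ≤ mTrans`, exchangeability lets each point of a sample of size `n + 1` play the test
point, and with a definite loss the labels of the sample are almost surely those of a hypothesis
(`expectedError_le_transRate`).

For `mTrans ≤ mExp + 1`, a transductive learner resamples its `k` training points with replacement
and runs the given learner on the resample. Under the uniform distribution on all `k + 1` labeled
points the given learner sees such a resample whenever its sample misses the test point, and this
has probability `(k / (k + 1)) ^ k > 1 / e` (`looLoss_resampleRule_le`).

For the upper bound on `mPAC`, about `6 L` independent copies of the given learner are trained on
disjoint blocks, where `L = log (1 / min ε δ)`. By Markov's inequality one of them has error at most
`3 ε / 4`, except with probability `(2 / 3) ^ (6 L)`. A common validation block of size of order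
`L / ε` separates the errors below `3 ε / 4` from those above `ε`, by a multiplicative Chernoff
bound and a union bound (`failureProb_boostRule_le`, `mPAC_le_mul_max`).

In the bound for a fixed problem the term `1 / ε` is absorbed by `mExp (ε / 2)`. If a learner has
small expected error `b` with `k` examples, look at the distributions with mass `1 / (k + 1)` at one
point and the rest at another: with probability at least `1 / e` the sample shows one point only, so
copies of one example already train this learner to expected error `e (k + 1) b` (`mExp_le_one_of_le`). Hence
either one example suffices for every error, where Markov's inequality gives `mPAC ≤ 1`, or
`mExp ε` is at least of order `1 / ε` (`div_lt_of_mExp_le`).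

For the coupon collector the number of draws is made Poisson of mean `n log n`. Each item is then
missed independently with probability `1 / n`, so exactly one is missed with probability
`(1 - 1 / n) ^ (n - 1) ≥ 1 / e`, and some deterministic number of draws does as well as this
average. In place of independence the proof uses the generating function `(exp t - 1) ^ k` of the numbers of
surjections (`hasSum_surjCount`).
-/

/-! ### Sample complexities as natural-number thresholds -/

lemma threshold_le_natCast_iff {good : ℕ → Prop} {m : ℕ} :
    threshold good ≤ m ↔ ∀ m' ≥ m, good m' := by
  constructor
  · intro h
    by_contra hm
    have : ((m + 1 : ℕ) : ℕ∞) ≤ threshold good := by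
      refine le_iInf₂ fun n hn => ?_
      by_contra hlt
      have hnm : n < m + 1 := by exact_mod_cast not_le.1 hlt
      exact hm fun m' hm' => hn m' (by omega)
    have := this.trans h
    norm_cast at this
    omega
  · intro h
    exact iInf₂_le m h

/-- An optimum over learners is attained as soon as it is finite. -/
lemma iInf_threshold_le_natCast_iff {ι : Type*} {good : ι → ℕ → Prop} {m : ℕ} :
    (⨅ A, threshold (good A)) ≤ m ↔ ∃ A, ∀ m' ≥ m, good A m' := by
  constructor
  · intro h
    have : (⨅ A, threshold (good A)) < ((m + 1 : ℕ) : ℕ∞) :=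
      h.trans_lt (by exact_mod_cast Nat.lt_succ_self m)
    obtain ⟨A, hA⟩ := iInf_lt_iff.1 this
    refine ⟨A, threshold_le_natCast_iff.1 ?_⟩
    rw [Nat.cast_add_one] at hA
    exact Order.le_of_lt_add_one hA
  · rintro ⟨A, hA⟩
    exact (iInf_le _ A).trans (threshold_le_natCast_iff.2 hA)

lemma ENat.le_of_forall_le_natCast {a b : ℕ∞} (h : ∀ m : ℕ, b ≤ m → a ≤ m) : a ≤ b := by
  induction b using ENat.recTopCoe with
  | top => exact le_top
  | coe m => exact h m le_rfl

section

variable {X : Type u} {Y : Type v} [MeasurableSpace X] [MeasurableSpace Y]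
  {ℓ : Y → Y → ℝ} {H : Set (X → Y)}

lemma mExp_le_natCast_iff {ε : ℝ} {m : ℕ} :
    mExp ℓ H ε ≤ m ↔ ∃ A : Learner X Y, ∀ m' ≥ m, ∀ D ∈ realizable ℓ H,
      expectedError ℓ (A m') D ≤ ENNReal.ofReal ε :=
  iInf_threshold_le_natCast_iff

lemma mPAC_le_natCast_iff {ε δ : ℝ} {m : ℕ} :
    mPAC ℓ H ε δ ≤ m ↔ ∃ A : Learner X Y, ∀ m' ≥ m, ∀ D ∈ realizable ℓ H,
      failureProb ℓ H (A m') D ε ≤ ENNReal.ofReal δ :=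
  iInf_threshold_le_natCast_iff

lemma mTrans_le_natCast_iff {ε : ℝ} {m : ℕ} :
    mTrans ℓ H ε ≤ m ↔ ∃ A : Learner X Y, ∀ m' ≥ m,
      transRate ℓ H A m' < ENNReal.ofReal ε :=
  iInf_threshold_le_natCast_iff

lemma mExp_antitone : Antitone (mExp ℓ H) := fun _ _ hε =>
  ENat.le_of_forall_le_natCast fun _ hm => by
    obtain ⟨A, hA⟩ := mExp_le_natCast_iff.1 hm
    exact mExp_le_natCast_iff.2
      ⟨A, fun m' hm' D hD => (hA m' hm' D hD).trans (ENNReal.ofReal_le_ofReal hε)⟩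

/-! ### Measurability and elementary bounds for errors -/

instance {n : ℕ} (R : LearningRule X Y n) (D : ProbabilityMeasure (X × Y)) :
    IsProbabilityMeasure (runLaw R D) := by
  unfold runLaw; infer_instance

lemma measurable_loss_predict (hℓ : Measurable (Function.uncurry ℓ)) {n : ℕ}
    (R : LearningRule X Y n) :
    Measurable fun q : (R.Seed × (Fin n → X × Y)) × X × Y =>
      ENNReal.ofReal (ℓ (R.predict q.1.1 q.1.2 q.2.1) q.2.2) := by
  have h1 : Measurable fun q : (R.Seed × (Fin n → X × Y)) × X × Y =>
      R.predict q.1.1 q.1.2 q.2.1 :=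
    R.measurable_predict.comp (f := fun q : (R.Seed × (Fin n → X × Y)) × X × Y =>
      (q.1.1, q.1.2, q.2.1)) (by fun_prop)
  exact (hℓ.comp (h1.prodMk (by fun_prop : Measurable fun q :
    (R.Seed × (Fin n → X × Y)) × X × Y => q.2.2))).ennreal_ofReal

lemma measurable_trueError_predict (hℓ : Measurable (Function.uncurry ℓ)) {n : ℕ}
    (R : LearningRule X Y n) (D : ProbabilityMeasure (X × Y)) :
    Measurable fun p : R.Seed × (Fin n → X × Y) => trueError ℓ D (R.predict p.1 p.2) :=
  (measurable_loss_predict hℓ R).lintegral_prod_right'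

lemma trueError_le_one (h1 : ∀ y y', ℓ y y' ≤ 1) (D : ProbabilityMeasure (X × Y)) (g : X → Y) :
    trueError ℓ D g ≤ 1 := by
  calc trueError ℓ D g ≤ ∫⁻ _, 1 ∂(D : Measure (X × Y)) :=
        lintegral_mono fun z => by simpa using h1 _ _
    _ = 1 := by simp

lemma iInf_trueError_of_realizable {D : ProbabilityMeasure (X × Y)} (hD : D ∈ realizable ℓ H) :
    ⨅ h ∈ H, trueError ℓ D h = 0 := by
  obtain ⟨h, hh, h0⟩ := hD
  exact le_antisymm ((iInf₂_le h hh).trans h0.le) bot_le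

lemma failureProb_of_realizable {n : ℕ} (R : LearningRule X Y n) {D : ProbabilityMeasure (X × Y)}
    (hD : D ∈ realizable ℓ H) (ε : ℝ) :
    failureProb ℓ H R D ε =
      runLaw R D {p | ENNReal.ofReal ε < trueError ℓ D (R.predict p.1 p.2)} := by
  simp only [failureProb, iInf_trueError_of_realizable hD, zero_add, not_le]

/-- A zero loss is almost surely zero pointwise. -/
lemma ae_loss_eq_zero (hℓ : Measurable (Function.uncurry ℓ)) (h0 : ∀ y y', 0 ≤ ℓ y y')
    {D : ProbabilityMeasure (X × Y)} {h : X → Y} (hm : Measurable h)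
    (hD : trueError ℓ D h = 0) : ∀ᵐ z ∂(D : Measure (X × Y)), ℓ (h z.1) z.2 = 0 := by
  have hmeas : Measurable fun z : X × Y => ENNReal.ofReal (ℓ (h z.1) z.2) :=
    (hℓ.comp ((hm.comp measurable_fst).prodMk measurable_snd)).ennreal_ofReal
  filter_upwards [(lintegral_eq_zero_iff hmeas).1 hD] with z hz
  exact le_antisymm (by simpa using hz) (h0 _ _)

/-! ### Expected error versus confidence -/

lemma expectedError_le_add_failureProb (hℓ : Measurable (Function.uncurry ℓ))
    (h1 : ∀ y y', ℓ y y' ≤ 1) {n : ℕ} (R : LearningRule X Y n) {D : ProbabilityMeasure (X × Y)}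
    (hD : D ∈ realizable ℓ H) (ε : ℝ) :
    expectedError ℓ R D ≤ ENNReal.ofReal ε + failureProb ℓ H R D ε := by
  have hmeas := measurable_trueError_predict hℓ R D
  rw [failureProb_of_realizable R hD]
  set B := {p : R.Seed × (Fin n → X × Y) |
    ENNReal.ofReal ε < trueError ℓ D (R.predict p.1 p.2)} with hB
  have hBm : MeasurableSet B := measurableSet_lt measurable_const hmeas
  -- Pointwise the error is at most `ε` off `B` and at most `1` on `B`.
  calc expectedError ℓ R D ≤ ∫⁻ p, ENNReal.ofReal ε + B.indicator 1 p ∂(runLaw R D) := by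
        refine lintegral_mono fun p => ?_
        by_cases hp : p ∈ B
        · simpa [hp] using (trueError_le_one h1 D _).trans le_add_self
        · simpa [hp] using not_lt.1 hp
    _ = _ := by
        rw [lintegral_add_left measurable_const, lintegral_indicator_one hBm]
        simp

lemma mExp_add_le_mPAC (hℓ : Measurable (Function.uncurry ℓ)) (h1 : ∀ y y', ℓ y y' ≤ 1)
    {ε δ : ℝ} (hε : 0 ≤ ε) (hδ : 0 ≤ δ) : mExp ℓ H (ε + δ) ≤ mPAC ℓ H ε δ := by
  refine ENat.le_of_forall_le_natCast fun m hm => ?_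
  obtain ⟨A, hA⟩ := mPAC_le_natCast_iff.1 hm
  refine mExp_le_natCast_iff.2 ⟨A, fun m' hm' D hD => ?_⟩
  rw [ENNReal.ofReal_add hε hδ]
  exact (expectedError_le_add_failureProb hℓ h1 _ hD ε).trans (by gcongr; exact hA m' hm' D hD)

lemma measure_lt_trueError_le (hℓ : Measurable (Function.uncurry ℓ)) {n : ℕ}
    (R : LearningRule X Y n) (D : ProbabilityMeasure (X × Y)) {a b : ℝ} (hb : 0 < b)
    (h : expectedError ℓ R D ≤ ENNReal.ofReal a) :
    runLaw R D {p | ENNReal.ofReal b < trueError ℓ D (R.predict p.1 p.2)} ≤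
      ENNReal.ofReal (a / b) := by
  have hb' : ENNReal.ofReal b ≠ 0 := by simpa using hb
  calc runLaw R D {p | ENNReal.ofReal b < trueError ℓ D (R.predict p.1 p.2)}
      ≤ runLaw R D {p | ENNReal.ofReal b ≤ trueError ℓ D (R.predict p.1 p.2)} :=
        measure_mono fun p hp => le_of_lt (α := ℝ≥0∞) hp
    _ ≤ expectedError ℓ R D / ENNReal.ofReal b :=
        meas_ge_le_lintegral_div (measurable_trueError_predict hℓ R D).aemeasurable hb'
          ENNReal.ofReal_ne_top
    _ ≤ _ := by
        rw [ENNReal.ofReal_div_of_pos hb]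
        gcongr

/-- Markov's inequality turns a learner of expected error `ε δ` into one of confidence `1 - δ`. -/
lemma mPAC_le_mExp_mul (hℓ : Measurable (Function.uncurry ℓ)) {ε : ℝ} (hε : 0 < ε) (δ : ℝ) :
    mPAC ℓ H ε δ ≤ mExp ℓ H (ε * δ) := by
  refine ENat.le_of_forall_le_natCast fun m hm => ?_
  obtain ⟨A, hA⟩ := mExp_le_natCast_iff.1 hm
  refine mPAC_le_natCast_iff.2 ⟨A, fun m' hm' D hD => ?_⟩
  rw [failureProb_of_realizable _ hD]
  refine (measure_lt_trueError_le hℓ _ D hε (hA m' hm' D hD)).trans_eq ?_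
  rw [mul_div_cancel_left₀ _ hε.ne']

end

/-! ### Exchanging the roles of training and test points -/

lemma Measurable.comp_countable_index {Ω ι β : Type*} [MeasurableSpace Ω] [MeasurableSpace ι]
    [MeasurableSpace β] [Countable ι] [MeasurableSingletonClass ι] {i : Ω → ι} {f : ι → Ω → β}
    (hi : Measurable i) (hf : ∀ j, Measurable (f j)) : Measurable fun ω => f (i ω) ω :=
  (measurable_from_prod_countable_right (f := fun q : ι × Ω => f q.1 q.2) hf).comp
    (hi.prodMk measurable_id)

lemma lintegral_uniformOn_univ {Ω : Type*} [Fintype Ω] [MeasurableSpace Ω]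
    [MeasurableSingletonClass Ω] (f : Ω → ℝ≥0∞) :
    ∫⁻ ω, f ω ∂(ProbabilityTheory.uniformOn Set.univ) = (∑ ω, f ω) / Fintype.card Ω := by
  rw [lintegral_fintype, div_eq_mul_inv, Finset.sum_mul]
  simp [ProbabilityTheory.uniformOn_univ, div_eq_mul_inv]

section

variable {X : Type u} {Y : Type v} [MeasurableSpace X] [MeasurableSpace Y]
  {ℓ : Y → Y → ℝ} {H : Set (X → Y)}

/-- The loss at the labeled point `z` of the rule `R` trained on `S`, averaged over the seed. -/
noncomputable def seedLoss (ℓ : Y → Y → ℝ) {n : ℕ} (R : LearningRule X Y n)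
    (S : Fin n → X × Y) (z : X × Y) : ℝ≥0∞ :=
  ∫⁻ ω, ENNReal.ofReal (ℓ (R.predict ω S z.1) z.2) ∂(R.seedLaw)

lemma measurable_seedLoss (hℓ : Measurable (Function.uncurry ℓ)) {n : ℕ}
    (R : LearningRule X Y n) :
    Measurable fun q : (Fin n → X × Y) × X × Y => seedLoss ℓ R q.1 q.2 := by
  unfold seedLoss
  exact ((measurable_loss_predict hℓ R).comp (f := fun q :
    ((Fin n → X × Y) × X × Y) × R.Seed => ((q.2, q.1.1), q.1.2))
    (by fun_prop)).lintegral_prod_right'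

lemma expectedError_eq_lintegral_seedLoss (hℓ : Measurable (Function.uncurry ℓ)) {n : ℕ}
    (R : LearningRule X Y n) (D : ProbabilityMeasure (X × Y)) :
    expectedError ℓ R D = ∫⁻ q, seedLoss ℓ R q.1 q.2
      ∂((Measure.pi fun _ : Fin n => (D : Measure (X × Y))).prod (D : Measure (X × Y))) := by
  have hm := measurable_loss_predict hℓ R
  rw [lintegral_prod _ (measurable_seedLoss hℓ R).aemeasurable, expectedError, runLaw,
    lintegral_prod_symm' _ (measurable_trueError_predict hℓ R D)]
  refine lintegral_congr fun S => ?_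
  simp only [trueError, seedLoss]
  exact lintegral_lintegral_swap (hm.comp (f := fun q : R.Seed × X × Y => ((q.1, S), q.2))
    (by fun_prop)).aemeasurable

lemma expectedError_map (hℓ : Measurable (Function.uncurry ℓ)) {n : ℕ}
    (R : LearningRule X Y n) {Ω : Type*} [MeasurableSpace Ω] (ν : Measure Ω)
    [IsProbabilityMeasure ν] {f : Ω → X × Y} (hf : Measurable f) (D : ProbabilityMeasure (X × Y))
    (hD : (D : Measure (X × Y)) = ν.map f) :
    expectedError ℓ R D = ∫⁻ σ, ∫⁻ i, seedLoss ℓ R (fun j => f (σ j)) (f i) ∂ν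
      ∂(Measure.pi fun _ : Fin n => ν) := by
  have hp := measurable_seedLoss hℓ R
  have : IsProbabilityMeasure (ν.map f) := Measure.isProbabilityMeasure_map hf.aemeasurable
  rw [expectedError_eq_lintegral_seedLoss hℓ, hD,
    ← Measure.pi_map_pi (μ := fun _ : Fin n => ν) (f := fun _ => f) fun _ => hf.aemeasurable,
    Measure.map_prod_map _ _ (by fun_prop) hf, lintegral_map hp (by fun_prop)]
  exact lintegral_prod _ (hp.comp (f := fun q : (Fin n → Ω) × Ω => (fun j => f (q.1 j), f q.2))
    (by fun_prop)).aemeasurable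

lemma transError_succ (A : Learner X Y) (k : ℕ) (S : Fin (k + 1) → X) (h : X → Y) :
    transError ℓ A (k + 1) S h =
      (∑ i, seedLoss ℓ (A k) (fun j => (S (i.succAbove j), h (S (i.succAbove j))))
        (S i, h (S i))) / ((k + 1 : ℕ) : ℝ≥0∞) := rfl

/-- By exchangeability every point of a sample of size `n + 1` may serve as the test point. -/
lemma expectedError_eq_lintegral_removeNth (hℓ : Measurable (Function.uncurry ℓ)) {n : ℕ}
    (R : LearningRule X Y n) (D : ProbabilityMeasure (X × Y)) (i : Fin (n + 1)) :
    expectedError ℓ R D = ∫⁻ T, seedLoss ℓ R (fun j => T (i.succAbove j)) (T i)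
      ∂(Measure.pi fun _ : Fin (n + 1) => (D : Measure (X × Y))) := by
  have h := measurePreserving_piFinSuccAbove (fun _ : Fin (n + 1) => (D : Measure (X × Y))) i
  have hm := measurable_seedLoss hℓ R
  rw [expectedError_eq_lintegral_seedLoss hℓ, ← lintegral_prod_swap]
  exact (h.lintegral_comp (hm.comp measurable_swap)).symm

/-- Averaging the leave-one-out losses over a random sample gives the expected error. -/
lemma expectedError_le_transRate (hℓ : Measurable (Function.uncurry ℓ))
    (h0 : ∀ y y', 0 ≤ ℓ y y') (hdef : ∀ y y', ℓ y y' = 0 → y = y')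
    (hH : ∀ h ∈ H, Measurable h) (A : Learner X Y) (n : ℕ)
    {D : ProbabilityMeasure (X × Y)} (hD : D ∈ realizable ℓ H) :
    expectedError ℓ (A n) D ≤ transRate ℓ H A (n + 1) := by
  obtain ⟨h, hh, hD0⟩ := hD
  have hne : ((n + 1 : ℕ) : ℝ≥0∞) ≠ 0 := by simp
  have hm := measurable_seedLoss hℓ (A n)
  have hlab : ∀ᵐ T ∂(Measure.pi fun _ : Fin (n + 1) => (D : Measure (X × Y))),
      ∀ i, (T i).2 = h (T i).1 := by
    refine ae_all_iff.2 fun i => ?_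
    exact (Measure.tendsto_eval_ae_ae (μ := fun _ : Fin (n + 1) => (D : Measure (X × Y)))
      (i := i)).eventually ((ae_loss_eq_zero hℓ h0 (hH h hh) hD0).mono
        fun z hz => (hdef _ _ hz).symm)
  calc expectedError ℓ (A n) D
      = (∑ _i : Fin (n + 1), expectedError ℓ (A n) D) / ((n + 1 : ℕ) : ℝ≥0∞) := by
        rw [Finset.sum_const, Finset.card_univ, Fintype.card_fin, nsmul_eq_mul,
          mul_comm, ENNReal.mul_div_cancel_right hne (ENNReal.natCast_ne_top _)]
    _ = ∫⁻ T, (∑ i, seedLoss ℓ (A n) (fun j => T (i.succAbove j)) (T i)) / ((n + 1 : ℕ) : ℝ≥0∞)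
          ∂(Measure.pi fun _ : Fin (n + 1) => (D : Measure (X × Y))) := by
        have hi (i : Fin (n + 1)) : Measurable fun T : Fin (n + 1) → X × Y =>
            seedLoss ℓ (A n) (fun j => T (i.succAbove j)) (T i) :=
          hm.comp (f := fun T : Fin (n + 1) → X × Y => (fun j => T (i.succAbove j), T i))
            (by fun_prop)
        simp only [div_eq_mul_inv]
        rw [lintegral_mul_const _ (Finset.measurable_sum _ fun i _ => hi i),
          lintegral_finsetSum _ fun i _ => hi i]
        simp only [← expectedError_eq_lintegral_removeNth hℓ]
    _ ≤ ∫⁻ _, transRate ℓ H A (n + 1)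
          ∂(Measure.pi fun _ : Fin (n + 1) => (D : Measure (X × Y))) := by
        refine lintegral_mono_ae (hlab.mono fun T hT => ?_)
        have hT' (i) : T i = ((T i).1, h (T i).1) := Prod.ext rfl (hT i)
        refine le_trans (le_of_eq ?_)
          (le_iSup_of_le (fun i => (T i).1) (le_iSup₂_of_le h hh le_rfl))
        rw [transError_succ]
        congr! 3 with i
        · exact funext fun j => hT' _
        · exact hT' i
    _ = transRate ℓ H A (n + 1) := by simp

lemma mExp_le_mTrans (hℓ : Measurable (Function.uncurry ℓ))
    (h0 : ∀ y y', 0 ≤ ℓ y y') (hdef : ∀ y y', ℓ y y' = 0 → y = y')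
    (hH : ∀ h ∈ H, Measurable h) (ε : ℝ) : mExp ℓ H ε ≤ mTrans ℓ H ε := by
  refine ENat.le_of_forall_le_natCast fun m hm => ?_
  obtain ⟨A, hA⟩ := mTrans_le_natCast_iff.1 hm
  exact mExp_le_natCast_iff.2 ⟨A, fun m' hm' D hD =>
    (expectedError_le_transRate hℓ h0 hdef hH A m' hD).trans (hA (m' + 1) (by omega)).le⟩

/-! ### Resampling the training points -/

/-- The rule that trains `R` on a resample, drawn uniformly with replacement, of its training
sample. -/
noncomputable def resampleRule {k : ℕ} (R : LearningRule X Y k) : LearningRule X Y k where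
  Seed := R.Seed × (Fin k → Fin k)
  seedLaw := R.seedLaw.prod (ProbabilityTheory.uniformOn Set.univ)
  isProbabilityMeasure_seedLaw := by
    have : Nonempty (Fin k → Fin k) := ⟨id⟩
    have := ProbabilityTheory.isProbabilityMeasure_uniformOn
      (s := (Set.univ : Set (Fin k → Fin k))) Set.finite_univ Set.univ_nonempty
    infer_instance
  predict ω S x := R.predict ω.1 (fun j => S (ω.2 j)) x
  measurable_predict := by
    refine Measurable.comp_countable_index
      (i := fun p : (R.Seed × (Fin k → Fin k)) × (Fin k → X × Y) × X => p.1.2)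
      (f := fun τ p => R.predict p.1.1 (fun j => p.2.1 (τ j)) p.2.2) (by fun_prop) fun τ => ?_
    exact R.measurable_predict.comp (f := fun p : (R.Seed × (Fin k → Fin k)) ×
      (Fin k → X × Y) × X => (p.1.1, (fun j => p.2.1 (τ j)), p.2.2)) (by fun_prop)

lemma seedLoss_resampleRule (hℓ : Measurable (Function.uncurry ℓ)) {k : ℕ}
    (R : LearningRule X Y k) (S : Fin k → X × Y) (z : X × Y) :
    seedLoss ℓ (resampleRule R) S z =
      (∑ τ : Fin k → Fin k, seedLoss ℓ R (fun j => S (τ j)) z) / ((k ^ k : ℕ) : ℝ≥0∞) := by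
  have : Nonempty (Fin k → Fin k) := ⟨id⟩
  have := ProbabilityTheory.isProbabilityMeasure_uniformOn
      (s := (Set.univ : Set (Fin k → Fin k))) Set.finite_univ Set.univ_nonempty
  have hm : Measurable fun p : (R.Seed × (Fin k → Fin k)) =>
      ENNReal.ofReal (ℓ (R.predict p.1 (fun j => S (p.2 j)) z.1) z.2) := by
    refine Measurable.comp_countable_index (i := fun p : R.Seed × (Fin k → Fin k) => p.2)
      (f := fun (τ : Fin k → Fin k) p =>
        ENNReal.ofReal (ℓ (R.predict p.1 (fun j => S (τ j)) z.1) z.2)) (by fun_prop) fun τ => ?_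
    exact (measurable_loss_predict hℓ R).comp (f := fun p : R.Seed × (Fin k → Fin k) =>
      ((p.1, fun j => S (τ j)), z)) (by fun_prop)
  change ∫⁻ p : R.Seed × (Fin k → Fin k),
    ENNReal.ofReal (ℓ (R.predict p.1 (fun j => S (p.2 j)) z.1) z.2)
    ∂(R.seedLaw.prod (ProbabilityTheory.uniformOn Set.univ)) = _
  rw [lintegral_prod_symm' _ hm, lintegral_uniformOn_univ]
  simp [seedLoss]

lemma succ_div_pow_lt_exp_one (k : ℕ) : ((k + 1 : ℝ) / k) ^ k < Real.exp 1 := by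
  rcases Nat.eq_zero_or_pos k with rfl | hk
  · simp
  have hk' : (0 : ℝ) < k := by exact_mod_cast hk
  have h : (k + 1 : ℝ) / k < Real.exp (1 / k) := by
    have := Real.add_one_lt_exp (x := 1 / (k : ℝ)) (by positivity)
    rwa [add_div, div_self hk'.ne', add_comm]
  calc ((k + 1 : ℝ) / k) ^ k < Real.exp (1 / k) ^ k := by gcongr
    _ = Real.exp 1 := by rw [← Real.exp_nat_mul]; congr 1; field_simp

/-- Let `D` be uniform on `k + 1` labeled points consistent with a hypothesis. A sample of size `k`
from `D` misses the test point with probability `(k / (k + 1)) ^ k`, and given this it is a resample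
of the other points. So the leave-one-out loss of the resampling rule is at most
`((k + 1) / k) ^ k` times the expected error under `D`; for `k = 0` the factor is `1`. -/
lemma looLoss_resampleRule_le (hℓ : Measurable (Function.uncurry ℓ)) {k : ℕ}
    (R : LearningRule X Y k) {b : ℝ}
    (hR : ∀ D ∈ realizable ℓ H, expectedError ℓ R D ≤ ENNReal.ofReal b)
    {h : X → Y} (hh : h ∈ H) (hm : Measurable h) (f : Fin (k + 1) → X × Y)
    (hf : ∀ i, ℓ (h (f i).1) (f i).2 = 0) :
    (∑ i, seedLoss ℓ (resampleRule R) (fun j => f (i.succAbove j)) (f i)) /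
      ((k + 1 : ℕ) : ℝ≥0∞) ≤ ENNReal.ofReal (((k + 1 : ℝ) / k) ^ k * b) := by
  have hfm : Measurable f := .of_discrete
  let ν : Measure (Fin (k + 1)) := ProbabilityTheory.uniformOn Set.univ
  have hν : IsProbabilityMeasure ν := ProbabilityTheory.isProbabilityMeasure_uniformOn
    Set.finite_univ Set.univ_nonempty
  let D : ProbabilityMeasure (X × Y) :=
    ⟨ν.map f, Measure.isProbabilityMeasure_map hfm.aemeasurable⟩
  have hD : D ∈ realizable ℓ H := by
    refine ⟨h, hh, ?_⟩
    have hm : Measurable fun z : X × Y => ENNReal.ofReal (ℓ (h z.1) z.2) :=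
      (hℓ.comp ((hm.comp measurable_fst).prodMk measurable_snd)).ennreal_ofReal
    change ∫⁻ z, ENNReal.ofReal (ℓ (h z.1) z.2) ∂(ν.map f) = 0
    rw [lintegral_map hm hfm]
    simp [hf]
  have hE := hR D hD
  rw [expectedError_map hℓ R ν hfm D rfl] at hE
  have hpi : (Measure.pi fun _ : Fin k => ν) =
      ProbabilityTheory.uniformOn (Set.univ : Set (Fin k → Fin (k + 1))) := by
    rw [← Set.pi_univ (Set.univ : Set (Fin k)), ProbabilityTheory.uniformOn_pi]
  simp only [hpi, lintegral_uniformOn_univ, ν, Fintype.card_fin, Fintype.card_fun] at hE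
  have hk0 : (((k + 1) ^ k : ℕ) : ℝ≥0∞) ≠ 0 := by positivity
  have hE' : ∑ σ : Fin k → Fin (k + 1), (∑ i, seedLoss ℓ R (fun j => f (σ j)) (f i)) /
      ((k + 1 : ℕ) : ℝ≥0∞) ≤ ((k + 1) ^ k : ℕ) * ENNReal.ofReal b := by
    rw [mul_comm]
    exact (ENNReal.div_le_iff hk0 (ENNReal.natCast_ne_top _)).1 hE
  have hkk : (0 : ℝ) < ((k ^ k : ℕ) : ℝ) := by
    exact_mod_cast Nat.pow_self_pos
  simp only [seedLoss_resampleRule hℓ]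
  calc (∑ i : Fin (k + 1), (∑ τ : Fin k → Fin k,
          seedLoss ℓ R (fun j => f (i.succAbove (τ j))) (f i)) / ((k ^ k : ℕ) : ℝ≥0∞)) /
          ((k + 1 : ℕ) : ℝ≥0∞)
      ≤ (∑ i : Fin (k + 1), (∑ σ : Fin k → Fin (k + 1),
          seedLoss ℓ R (fun j => f (σ j)) (f i)) / ((k ^ k : ℕ) : ℝ≥0∞)) /
          ((k + 1 : ℕ) : ℝ≥0∞) := by
        gcongr with i
        -- Resamples of the points other than `i` are the samples `σ` that miss `i`.
        have hinj : Function.Injective fun (τ : Fin k → Fin k) j => i.succAbove (τ j) :=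
          (Fin.succAbove_right_injective (p := i)).comp_left
        rw [← Finset.sum_image (f := fun σ => seedLoss ℓ R (fun j => f (σ j)) (f i))
          (s := Finset.univ) hinj.injOn]
        exact Finset.sum_le_sum_of_subset (Finset.subset_univ _)
    _ = (∑ σ : Fin k → Fin (k + 1), (∑ i, seedLoss ℓ R (fun j => f (σ j)) (f i)) /
          ((k + 1 : ℕ) : ℝ≥0∞)) / ((k ^ k : ℕ) : ℝ≥0∞) := by
        simp only [div_eq_mul_inv, ← Finset.sum_mul]
        rw [Finset.sum_comm, mul_right_comm]
    _ ≤ ((k + 1) ^ k : ℕ) * ENNReal.ofReal b / ((k ^ k : ℕ) : ℝ≥0∞) := by gcongr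
    _ = ENNReal.ofReal (((k + 1 : ℝ) / k) ^ k * b) := by
        rw [← ENNReal.ofReal_natCast, ← ENNReal.ofReal_natCast,
          ← ENNReal.ofReal_mul (by positivity), ← ENNReal.ofReal_div_of_pos hkk, div_pow]
        congr 1
        push_cast
        ring

lemma mTrans_le_mExp_add_one (hℓ : Measurable (Function.uncurry ℓ)) (hrefl : ∀ y, ℓ y y = 0)
    (hH : ∀ h ∈ H, Measurable h) {ε : ℝ} (hε : 0 < ε) :
    mTrans ℓ H ε ≤ mExp ℓ H (ε / Real.exp 1) + 1 := by
  rcases eq_or_ne (mExp ℓ H (ε / Real.exp 1)) ⊤ with ht | ht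
  · simp [ht]
  obtain ⟨m, hm⟩ := ENat.ne_top_iff_exists.1 ht
  obtain ⟨A, hA⟩ := mExp_le_natCast_iff.1 hm.ge
  rw [← hm]
  refine mTrans_le_natCast_iff (m := m + 1) |>.2 ⟨fun n => resampleRule (A n), fun m' hm' => ?_⟩
  obtain ⟨k, rfl⟩ : ∃ k, m' = k + 1 := ⟨m' - 1, by omega⟩
  have hrate : transRate ℓ H (fun n => resampleRule (A n)) (k + 1) ≤
      ENNReal.ofReal (((k + 1 : ℝ) / k) ^ k * (ε / Real.exp 1)) :=
    iSup_le fun S => iSup₂_le fun h hh =>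
      looLoss_resampleRule_le hℓ (A k) (hA k (by omega)) hh (hH h hh) (fun i => (S i, h (S i)))
        fun i => hrefl _
  refine hrate.trans_lt ((ENNReal.ofReal_lt_ofReal_iff hε).2 ?_)
  have hexp := Real.exp_pos 1
  calc ((k + 1 : ℝ) / k) ^ k * (ε / Real.exp 1)
      < Real.exp 1 * (ε / Real.exp 1) := by gcongr; exact succ_div_pow_lt_exp_one k
    _ = ε := by field_simp

/-! ### A lower bound on the sample complexity beyond one example -/

/-- The rule that trains `R` on copies of the first example only. -/
def repeatFirstRule {k : ℕ} (R : LearningRule X Y k) (n : ℕ) : LearningRule X Y (n + 1) where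
  Seed := R.Seed
  seedLaw := R.seedLaw
  predict ω S x := R.predict ω (fun _ => S 0) x
  measurable_predict := R.measurable_predict.comp (f := fun p : R.Seed ×
    (Fin (n + 1) → X × Y) × X => (p.1, (fun _ => p.2.1 0), p.2.2)) (by fun_prop)

/-- If one example and a test point are consistent with the same hypothesis, consider the
distribution with mass `1 / (k + 1)` at the test point and the rest at the example. The sample
then consists of copies of the example with probability at least `1 / e`. -/
lemma seedLoss_const_le (hℓ : Measurable (Function.uncurry ℓ)) {k : ℕ}
    (R : LearningRule X Y k) {b : ℝ} (hb : 0 ≤ b)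
    (hR : ∀ D ∈ realizable ℓ H, expectedError ℓ R D ≤ ENNReal.ofReal b)
    {h : X → Y} (hh : h ∈ H) (hm : Measurable h) {z₀ z₁ : X × Y}
    (h₀ : ℓ (h z₀.1) z₀.2 = 0) (h₁ : ℓ (h z₁.1) z₁.2 = 0) :
    seedLoss ℓ R (fun _ => z₀) z₁ ≤ ENNReal.ofReal (Real.exp 1 * (k + 1) * b) := by
  obtain ⟨f, hf0, hfs⟩ : ∃ f : Fin (k + 1) → X × Y, f 0 = z₁ ∧ ∀ j, f (Fin.succ j) = z₀ :=
    ⟨Fin.cons z₁ fun _ => z₀, rfl, fun _ => rfl⟩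
  have hne : ((k + 1 : ℕ) : ℝ≥0∞) ≠ 0 := by simp
  have key := looLoss_resampleRule_le hℓ R hR hh hm f
    (Fin.cases (by rwa [hf0]) fun j => by rwa [hfs])
  rw [ENNReal.div_le_iff hne (ENNReal.natCast_ne_top _)] at key
  -- A resample of copies of `z₀` consists of copies of `z₀`.
  have h0 : seedLoss ℓ (resampleRule R) (fun j => f ((0 : Fin (k + 1)).succAbove j)) (f 0) =
      seedLoss ℓ R (fun _ => z₀) z₁ := by
    have hkk : ((k ^ k : ℕ) : ℝ≥0∞) ≠ 0 := by exact_mod_cast Nat.pow_self_pos.ne'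
    simp only [seedLoss_resampleRule hℓ, hf0, hfs, Fin.zero_succAbove,
      Finset.sum_const, Finset.card_univ, Fintype.card_fun, Fintype.card_fin, nsmul_eq_mul]
    rw [mul_comm, ENNReal.mul_div_cancel_right hkk (ENNReal.natCast_ne_top _)]
  rw [← h0]
  refine (Finset.single_le_sum (f := fun i => seedLoss ℓ (resampleRule R)
    (fun j => f (i.succAbove j)) (f i)) (fun _ _ => zero_le) (Finset.mem_univ 0)).trans
    (key.trans ?_)
  rw [← ENNReal.ofReal_natCast, ← ENNReal.ofReal_mul (by positivity)]
  refine ENNReal.ofReal_le_ofReal ?_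
  push_cast
  calc ((k + 1 : ℝ) / k) ^ k * b * (k + 1) ≤ Real.exp 1 * b * (k + 1) := by
        gcongr; exact (succ_div_pow_lt_exp_one k).le
    _ = _ := by ring

/-- A learner that needs few examples for a small error can do with a single example for a
moderate error. -/
lemma mExp_le_one_of_le (hℓ : Measurable (Function.uncurry ℓ)) (h0 : ∀ y y', 0 ≤ ℓ y y')
    (hH : ∀ h ∈ H, Measurable h) {b : ℝ} (hb : 0 ≤ b) {k : ℕ} (hk : mExp ℓ H b ≤ k) :
    mExp ℓ H (Real.exp 1 * (k + 1) * b) ≤ 1 := by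
  obtain ⟨A, hA⟩ := mExp_le_natCast_iff.1 hk
  refine mExp_le_natCast_iff (m := 1) |>.2 ⟨fun n => match n with
    | 0 => A 0
    | n + 1 => repeatFirstRule (A k) n, fun m' hm' D hD => ?_⟩
  obtain ⟨n, rfl⟩ : ∃ n, m' = n + 1 := ⟨m' - 1, by omega⟩
  obtain ⟨h, hh, hD0⟩ := hD
  have hae := ae_loss_eq_zero hℓ h0 (hH h hh) hD0
  rw [expectedError_eq_lintegral_seedLoss hℓ,
    lintegral_prod _ (measurable_seedLoss hℓ _).aemeasurable]
  have hfirst := (Measure.tendsto_eval_ae_ae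
    (μ := fun _ : Fin (n + 1) => (D : Measure (X × Y))) (i := 0)).eventually hae
  calc _ ≤ ∫⁻ _ : Fin (n + 1) → X × Y, ∫⁻ _ : X × Y,
          ENNReal.ofReal (Real.exp 1 * (k + 1) * b) ∂(D : Measure (X × Y))
          ∂(Measure.pi fun _ : Fin (n + 1) => (D : Measure (X × Y))) := by
        refine lintegral_mono_ae (hfirst.mono fun S hS => lintegral_mono_ae (hae.mono
          fun z hz => ?_))
        exact seedLoss_const_le hℓ (A k) hb (hA k le_rfl) hh (hH h hh) hS hz
    _ = _ := by simp

/-- If one example does not suffice for error `η`, the sample complexity grows at least like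
`1 / ε`. -/
lemma div_lt_of_mExp_le (hℓ : Measurable (Function.uncurry ℓ)) (h0 : ∀ y y', 0 ≤ ℓ y y')
    (hH : ∀ h ∈ H, Measurable h) {η b : ℝ} (hη : 1 < mExp ℓ H η) (hb : 0 ≤ b) {k : ℕ}
    (hk : mExp ℓ H b ≤ k) : η < Real.exp 1 * (k + 1) * b := by
  by_contra! hle
  exact absurd ((mExp_antitone hle).trans (mExp_le_one_of_le hℓ h0 hH hb hk)) (not_le.2 hη)

end

/-! ### The coupon collector with one missing item -/

/-- The number of maps from `m` draws onto `k` items. -/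
noncomputable def surjCount (m k : ℕ) : ℕ :=
  Nat.card {f : Fin m → Fin k // Function.Surjective f}

lemma card_filter_image_eq {m : ℕ} {α : Type*} [Fintype α] [DecidableEq α] (s : Finset α) :
    (Finset.univ.filter fun f : Fin m → α => Finset.univ.image f = s).card =
      surjCount m s.card := by
  rw [surjCount, ← Fintype.card_subtype, ← Nat.card_eq_fintype_card]
  refine Nat.card_congr (Equiv.trans (β := {g : Fin m → s // Function.Surjective g}) ?_ ?_)
  · exact
    { toFun := fun f => ⟨fun i => ⟨f.1 i, by
          simpa only [f.2] using Finset.mem_image_of_mem f.1 (Finset.mem_univ i)⟩, by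
        rintro ⟨y, hy⟩
        rw [← f.2] at hy
        obtain ⟨i, -, hi⟩ := Finset.mem_image.1 hy
        exact ⟨i, Subtype.ext hi⟩⟩
      invFun := fun g => ⟨fun i => g.1 i, by
        ext y
        simp only [Finset.mem_image, Finset.mem_univ, true_and]
        constructor
        · rintro ⟨i, rfl⟩
          exact (g.1 i).2
        · intro hy
          obtain ⟨i, hi⟩ := g.2 ⟨y, hy⟩
          exact ⟨i, by rw [hi]⟩⟩
      left_inv := fun _ => rfl
      right_inv := fun _ => rfl }
  · refine (Equiv.arrowCongr (Equiv.refl _) s.equivFin).subtypeEquiv fun g => ?_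
    simp [Equiv.arrowCongr]

lemma card_filter_card_image_eq (m n k : ℕ) :
    (Finset.univ.filter fun f : Fin m → Fin n => (Finset.univ.image f).card = k).card =
      n.choose k * surjCount m k := by
  rw [Finset.card_eq_sum_card_fiberwise (f := fun f : Fin m → Fin n => Finset.univ.image f)
    (t := Finset.powersetCard k Finset.univ)]
  · rw [Finset.sum_congr rfl (g := fun _ => surjCount m k)]
    · simp
    · intro s hs
      rw [Finset.mem_powersetCard] at hs
      rw [Finset.filter_filter, ← hs.2, ← card_filter_image_eq]
      congr 1
      ext f
      simp only [Finset.mem_filter, Finset.mem_univ, true_and, and_iff_right_iff_imp]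
      rintro rfl
      rfl
  · intro f hf
    simpa using hf

lemma sum_choose_mul_surjCount (m k : ℕ) :
    ∑ j ∈ Finset.range (k + 1), k.choose j * surjCount m j = k ^ m := by
  simp only [← card_filter_card_image_eq]
  rw [← Finset.card_eq_sum_card_fiberwise
    (f := fun f : Fin m → Fin k => (Finset.univ.image f).card)]
  · simp
  · intro f _
    have := Finset.card_le_univ (Finset.univ.image f)
    simp only [Fintype.card_fin] at this
    simpa using Nat.lt_succ_of_le this

/-- The exponential generating function of the number of surjections: both sides solve the
binomial inversion problem for `exp (k t)`. -/
lemma hasSum_surjCount (t : ℝ) (k : ℕ) :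
    HasSum (fun m : ℕ => (surjCount m k : ℝ) * (t ^ m / m.factorial)) ((Real.exp t - 1) ^ k) := by
  induction k using Nat.strong_induction_on with
  | _ k ih =>
    have hexp : HasSum (fun m : ℕ => (k : ℝ) ^ m * (t ^ m / m.factorial)) (Real.exp (k * t)) := by
      have := NormedSpace.expSeries_div_hasSum_exp (𝔸 := ℝ) (k * t)
      rw [← Real.exp_eq_exp_ℝ] at this
      simpa only [mul_pow, mul_div_assoc] using this
    have hlow : HasSum (fun m : ℕ => ∑ j ∈ Finset.range k,
        (k.choose j : ℝ) * ((surjCount m j : ℝ) * (t ^ m / m.factorial)))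
        (∑ j ∈ Finset.range k, (k.choose j : ℝ) * (Real.exp t - 1) ^ j) :=
      hasSum_sum fun j hj => (ih j (Finset.mem_range.1 hj)).mul_left _
    -- Sort all maps by their image and subtract those with fewer than `k` values.
    convert hexp.sub hlow using 1
    · rfl
    · funext m
      have := sum_choose_mul_surjCount m k
      rw [Finset.sum_range_succ, Nat.choose_self, one_mul] at this
      rw [← Nat.cast_pow, ← this]
      push_cast
      rw [add_mul, Finset.sum_mul]
      simp only [mul_assoc, add_sub_cancel_left]
    · have h := add_pow (Real.exp t - 1) 1 k
      rw [sub_add_cancel, ← Real.exp_nat_mul, Finset.sum_range_succ] at h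
      rw [h]
      simp [mul_comm]

/-- The number of draws is randomized: a Poisson number of draws of mean `n log n` misses each
item independently with probability `1 / n`, hence misses exactly one with probability
`(1 - 1 / n) ^ (n - 1) ≥ 1 / e`, and some fixed number of draws does at least as well. -/
lemma exists_le_mul_surjCount (k : ℕ) :
    ∃ m : ℕ, ((k + 1 : ℕ) : ℝ) ^ m / Real.exp 1 ≤ ((k + 1 : ℕ) : ℝ) * surjCount m k := by
  by_contra! hcon
  set n : ℝ := ((k + 1 : ℕ) : ℝ) with hn
  have hn1 : 1 ≤ n := by rw [hn]; exact_mod_cast Nat.succ_le_succ (Nat.zero_le k)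
  have hn0 : 0 < n := by linarith
  have ht : 0 ≤ Real.log n := Real.log_nonneg hn1
  have h1 := (hasSum_surjCount (Real.log n) k).mul_left n
  have h2 : HasSum (fun m : ℕ => n ^ m / Real.exp 1 * (Real.log n ^ m / m.factorial))
      (n ^ (k + 1) / Real.exp 1) := by
    have := (NormedSpace.expSeries_div_hasSum_exp (𝔸 := ℝ) (n * Real.log n)).div_const (Real.exp 1)
    rw [← Real.exp_eq_exp_ℝ] at this
    convert this using 1
    · rfl
    · funext m
      rw [mul_pow]
      ring
    · rw [hn, Real.exp_nat_mul, ← hn, Real.exp_log hn0]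
  have hle := hasSum_le (fun m => by
    rw [← mul_assoc]
    exact mul_le_mul_of_nonneg_right (hcon m).le (by positivity)) h1 h2
  rw [Real.exp_log hn0, pow_succ', mul_div_assoc, mul_le_mul_iff_right₀ hn0,
    le_div_iff₀ (Real.exp_pos 1)] at hle
  have hk := succ_div_pow_lt_exp_one k
  have hkk : (0 : ℝ) < (k : ℝ) ^ k := by
    rcases Nat.eq_zero_or_pos k with rfl | hk
    · simp
    · positivity
  rw [div_pow, div_lt_iff₀ hkk] at hk
  have : n - 1 = k := by rw [hn]; push_cast; ring
  rw [this] at hle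
  have : n = k + 1 := by rw [hn]; push_cast; ring
  rw [this] at hle
  linarith [mul_comm (Real.exp 1) ((k : ℝ) ^ k)]

lemma exists_coupon_draws (n : ℕ) (hn : 1 ≤ n) : ∃ m : ℕ,
    ENNReal.ofReal (1 / Real.exp 1) ≤
      Measure.pi (fun _ : Fin m => ProbabilityTheory.uniformOn (Set.univ : Set (Fin n)))
        {f | (Set.range f).ncard = n - 1} := by
  obtain ⟨k, rfl⟩ : ∃ k, n = k + 1 := ⟨n - 1, by omega⟩
  obtain ⟨m, hm⟩ := exists_le_mul_surjCount k
  refine ⟨m, ?_⟩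
  have hpow : (0 : ℝ) < ((k + 1 : ℕ) : ℝ) ^ m := by positivity
  rw [← ProbabilityTheory.uniformOn_pi, Set.pi_univ, ProbabilityTheory.uniformOn_univ]
  have hset : {f : Fin m → Fin (k + 1) | (Set.range f).ncard = k + 1 - 1} =
      ↑(Finset.univ.filter fun f : Fin m → Fin (k + 1) => (Finset.univ.image f).card = k) := by
    ext f
    have : Set.range f = ↑(Finset.univ.image f) := by simp
    rw [Set.mem_ofPred_eq, this, Set.ncard_coe_finset]
    simp
  rw [hset, Measure.count_apply_finset, card_filter_card_image_eq, Nat.choose_succ_self_right]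
  simp only [Fintype.card_fun, Fintype.card_fin]
  rw [← ENNReal.ofReal_natCast, ← ENNReal.ofReal_natCast, ← ENNReal.ofReal_div_of_pos (by
    exact_mod_cast hpow)]
  refine ENNReal.ofReal_le_ofReal ?_
  push_cast at hm hpow ⊢
  rw [le_div_iff₀ hpow]
  calc _ = _ := by ring
    _ ≤ _ := hm

/-! ### A multiplicative Chernoff bound for `[0, 1]`-valued variables -/

section

variable {Z : Type*} [MeasurableSpace Z] {P : Measure Z} [IsProbabilityMeasure P] {f : Z → ℝ}

lemma integrable_exp_mul_of_mem_Icc (hf : Measurable f) (h01 : ∀ z, 0 ≤ f z ∧ f z ≤ 1) (s : ℝ) :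
    Integrable (fun z => Real.exp (s * f z)) P := by
  refine Integrable.of_bound (by fun_prop) (Real.exp |s|) (ae_of_all _ fun z => ?_)
  rw [Real.norm_of_nonneg (Real.exp_nonneg _), Real.exp_le_exp]
  calc s * f z ≤ |s * f z| := le_abs_self _
    _ = |s| * f z := by rw [abs_mul, abs_of_nonneg (h01 z).1]
    _ ≤ |s| * 1 := by gcongr; exact (h01 z).2
    _ = |s| := mul_one _

lemma integral_exp_mul_le (hf : Measurable f) (h01 : ∀ z, 0 ≤ f z ∧ f z ≤ 1) {s : ℝ}
    (hs : |s| ≤ 1) :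
    ∫ z, Real.exp (s * f z) ∂P ≤ Real.exp ((s + s ^ 2) * ∫ z, f z ∂P) := by
  have hint : Integrable f P := Integrable.of_bound hf.aestronglyMeasurable 1
    (ae_of_all _ fun z => by rw [Real.norm_of_nonneg (h01 z).1]; exact (h01 z).2)
  have hconv (z : Z) : Real.exp (s * f z) ≤ 1 + (Real.exp s - 1) * f z := by
    have := convexOn_exp.2 (Set.mem_univ 0) (Set.mem_univ s) (sub_nonneg.2 (h01 z).2) (h01 z).1
      (by ring)
    simp only [smul_eq_mul, mul_zero, zero_add, Real.exp_zero] at this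
    rw [mul_comm s]
    linarith
  have hes : Real.exp s - 1 ≤ s + s ^ 2 := by
    have := (abs_le.1 (Real.abs_exp_sub_one_sub_id_le hs)).2
    linarith
  calc ∫ z, Real.exp (s * f z) ∂P ≤ ∫ z, (1 + (Real.exp s - 1) * f z) ∂P :=
        integral_mono (integrable_exp_mul_of_mem_Icc hf h01 s)
          ((integrable_const 1).add (hint.const_mul _)) hconv
    _ = (Real.exp s - 1) * ∫ z, f z ∂P + 1 := by
        rw [integral_add (integrable_const 1) (hint.const_mul _), integral_const_mul]
        simp [add_comm]
    _ ≤ (s + s ^ 2) * ∫ z, f z ∂P + 1 := by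
        gcongr
        exact integral_nonneg fun z => (h01 z).1
    _ ≤ _ := Real.add_one_le_exp _

lemma measure_le_sum_mul_le_exp (hf : Measurable f) (h01 : ∀ z, 0 ≤ f z ∧ f z ≤ 1) {s : ℝ}
    (hs : |s| ≤ 1) (N : ℕ) (a : ℝ) :
    (Measure.pi fun _ : Fin N => P) {V | a ≤ ∑ j, s * f (V j)} ≤
      ENNReal.ofReal (Real.exp (-a + N * ((s + s ^ 2) * ∫ z, f z ∂P))) := by
  -- Chernoff's method at exponent `1`, the factor `s` being part of the summands, so that one
  -- statement covers both tails.
  let W : Fin N → (Fin N → Z) → ℝ := fun j V => s * f (V j)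
  have hind : ProbabilityTheory.iIndepFun W (Measure.pi fun _ : Fin N => P) :=
    ProbabilityTheory.iIndepFun_pi (X := fun _ z => s * f z) fun _ => by fun_prop
  have hWm (j) : Measurable (W j) := by fun_prop
  have hmgf (j) : ProbabilityTheory.mgf (W j) (Measure.pi fun _ : Fin N => P) 1 =
      ∫ z, Real.exp (s * f z) ∂P := by
    have := integral_map (μ := Measure.pi fun _ : Fin N => P)
      (measurable_pi_apply j).aemeasurable (f := fun z => Real.exp (s * f z)) (by fun_prop)
    rw [(measurePreserving_eval (fun _ : Fin N => P) j).map_eq] at this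
    simp [ProbabilityTheory.mgf, W, this]
  have hint : Integrable (fun V => Real.exp (1 * (∑ j, W j) V))
      (Measure.pi fun _ : Fin N => P) :=
    hind.integrable_exp_mul_sum hWm fun j _ => by
      have := integrable_exp_mul_of_mem_Icc (P := P) hf h01 s
      simpa [W, Function.comp_def] using
        (measurePreserving_eval (fun _ : Fin N => P) j).integrable_comp_of_integrable this
  have h := ProbabilityTheory.measure_ge_le_exp_mul_mgf a zero_le_one hint
  rw [hind.mgf_sum hWm, Finset.prod_congr rfl fun j _ => hmgf j, Finset.prod_const,
    Finset.card_univ, Fintype.card_fin] at h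
  have hset : {V : Fin N → Z | a ≤ ∑ j, s * f (V j)} = {V | a ≤ (∑ j, W j) V} := by
    ext V; simp [W]
  rw [hset, ← ENNReal.ofReal_toReal (measure_ne_top _ _)]
  refine ENNReal.ofReal_le_ofReal (h.trans ?_)
  rw [Real.exp_add, neg_one_mul, Real.exp_nat_mul]
  gcongr
  exact integral_exp_mul_le hf h01 hs

/-- A mean above `ε` is unlikely to show an empirical mean of at most `7 ε / 8`. -/
lemma measure_sum_le_of_lt_mean (hf : Measurable f) (h01 : ∀ z, 0 ≤ f z ∧ f z ≤ 1) {ε : ℝ}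
    (hε : ε ≤ ∫ z, f z ∂P) (N : ℕ) :
    (Measure.pi fun _ : Fin N => P) {V | ∑ j, f (V j) ≤ 7 / 8 * ε * N} ≤
      ENNReal.ofReal (Real.exp (-(ε * N / 256))) := by
  refine le_trans (measure_mono fun V hV => ?_) ((measure_le_sum_mul_le_exp (s := -(1 / 16)) hf h01
    (by norm_num [abs_le]) N (-(1 / 16) * (7 / 8 * ε * N))).trans (ENNReal.ofReal_le_ofReal
      (Real.exp_le_exp.2 ?_)))
  · simp only [Set.mem_ofPred_eq, ← Finset.mul_sum] at hV ⊢
    linarith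
  -- With `s = -1 / 16` the exponent is at most `(7 / 8 / 16 - 1 / 16 + 1 / 256) ε N = -ε N / 256`.
  · nlinarith [mul_le_mul_of_nonneg_left hε (Nat.cast_nonneg (α := ℝ) N)]

/-- A mean of at most `3 ε / 4` is unlikely to show an empirical mean above `7 ε / 8`. -/
lemma measure_lt_sum_of_mean_le (hf : Measurable f) (h01 : ∀ z, 0 ≤ f z ∧ f z ≤ 1) {ε : ℝ}
    (hε0 : 0 ≤ ε) (hε : ∫ z, f z ∂P ≤ 3 / 4 * ε) (N : ℕ) :
    (Measure.pi fun _ : Fin N => P) {V | 7 / 8 * ε * N < ∑ j, f (V j)} ≤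
      ENNReal.ofReal (Real.exp (-(ε * N / 256))) := by
  refine le_trans (measure_mono fun V hV => ?_) ((measure_le_sum_mul_le_exp (s := 1 / 16) hf h01
    (by norm_num [abs_le]) N (1 / 16 * (7 / 8 * ε * N))).trans (ENNReal.ofReal_le_ofReal
      (Real.exp_le_exp.2 ?_)))
  · simp only [Set.mem_ofPred_eq, ← Finset.mul_sum] at hV ⊢
    linarith
  -- With `s = 1 / 16` the exponent is at most `(-7 / 8 / 16 + 3 / 4 * (1 / 16 + 1 / 256)) ε N`.
  · nlinarith [mul_le_mul_of_nonneg_left hε (Nat.cast_nonneg (α := ℝ) N),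
      mul_nonneg hε0 (Nat.cast_nonneg (α := ℝ) N)]

end

/-! ### Splitting a sample into blocks -/

lemma measurePreserving_comp_injective {α β Z : Type*} [Fintype α] [Fintype β]
    [MeasurableSpace Z] (P : Measure Z) [IsProbabilityMeasure P] {ι : α → β}
    (hι : Function.Injective ι) :
    MeasurePreserving (fun (S : β → Z) a => S (ι a)) (Measure.pi fun _ => P)
      (Measure.pi fun _ => P) where
  measurable := by fun_prop
  map_eq := by
    classical
    refine (Measure.pi_eq fun s hs => ?_).symm
    rw [Measure.map_apply (by fun_prop) (MeasurableSet.univ_pi hs)]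
    have : (fun (S : β → Z) a => S (ι a)) ⁻¹' (Set.univ.pi s) =
        Set.univ.pi fun b => ⋂ a ∈ {a | ι a = b}, s a := by
      ext S
      simp only [Set.mem_preimage, Set.mem_pi, Set.mem_univ, true_implies, Set.mem_iInter,
        Set.mem_ofPred_eq]
      exact ⟨fun h b a ha => ha ▸ h a, fun h a => h _ a rfl⟩
    rw [this, Measure.pi_pi]
    symm
    refine Finset.prod_of_injOn ι hι.injOn (by simp) (fun b _ hb => ?_) fun a _ => ?_
    · have : {a | ι a = b} = ∅ := by
        ext a
        simp only [Set.mem_ofPred_eq, Set.mem_empty_iff_false, iff_false]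
        rintro rfl
        simp at hb
      simp [this]
    · have : {a' | ι a' = ι a} = {a} := by
        ext a'
        simp [hι.eq_iff]
      simp [this]

/-- The seeds and the sample, rearranged into one seed and one training block for each of the `k`
candidates and a validation block. -/
def splitBlocks {Ω Z : Type*} {k M N n : ℕ} (ι : (Fin k × Fin M) ⊕ Fin N → Fin n)
    (p : (Fin k → Ω) × (Fin n → Z)) : (Fin k → Ω × (Fin M → Z)) × (Fin N → Z) :=
  (fun i => (p.1 i, fun j => p.2 (ι (.inl (i, j)))), fun j => p.2 (ι (.inr j)))

lemma measurePreserving_splitBlocks {Ω Z : Type*} [MeasurableSpace Ω] [MeasurableSpace Z]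
    (Q : Measure Ω) [IsProbabilityMeasure Q] (P : Measure Z) [IsProbabilityMeasure P]
    {k M N n : ℕ} {ι : (Fin k × Fin M) ⊕ Fin N → Fin n} (hι : Function.Injective ι) :
    MeasurePreserving (splitBlocks (Ω := Ω) (Z := Z) ι)
      ((Measure.pi fun _ => Q).prod (Measure.pi fun _ => P))
      ((Measure.pi fun _ => Q.prod (Measure.pi fun _ => P)).prod (Measure.pi fun _ => P)) := by
  have h1 := (MeasurePreserving.id (Measure.pi fun _ : Fin k => Q)).prod
    ((measurePreserving_sumPiEquivProdPi fun _ : (Fin k × Fin M) ⊕ Fin N => P).comp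
      (measurePreserving_comp_injective P hι))
  have hcurry : MeasurePreserving (MeasurableEquiv.curry (Fin k) (Fin M) Z)
      (Measure.pi fun _ => P) (Measure.pi fun _ => Measure.pi fun _ => P) := by
    refine ⟨(MeasurableEquiv.curry (Fin k) (Fin M) Z).measurable, ?_⟩
    simpa only [Measure.infinitePi_eq_pi] using
      Measure.infinitePi_map_curry (fun (_ : Fin k) (_ : Fin M) => P)
  have h2 := (MeasurePreserving.id (Measure.pi fun _ : Fin k => Q)).prod
    (hcurry.prod (MeasurePreserving.id (Measure.pi fun _ : Fin N => P)))
  have h3 := (measurePreserving_prodAssoc (Measure.pi fun _ : Fin k => Q)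
    (Measure.pi fun _ : Fin k => Measure.pi fun _ : Fin M => P)
    (Measure.pi fun _ : Fin N => P)).symm
  have h4 := ((measurePreserving_arrowProdEquivProdArrow Ω (Fin M → Z) (Fin k) (fun _ => Q)
    fun _ => Measure.pi fun _ => P).symm).prod
      (MeasurePreserving.id (Measure.pi fun _ : Fin N => P))
  exact h4.comp (h3.comp (h2.comp h1))

/-! ### Boosting the confidence by validation -/

section

variable {X : Type u} {Y : Type v} [MeasurableSpace X] [MeasurableSpace Y]
  {ℓ : Y → Y → ℝ} {H : Set (X → Y)}

/-- Some index where `d` holds; it is `0` if there is none. -/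
noncomputable def pickTrue {k : ℕ} (d : Fin (k + 1) → Bool) : Fin (k + 1) :=
  open Classical in if h : ∃ i, d i = true then h.choose else 0

lemma pickTrue_spec {k : ℕ} {d : Fin (k + 1) → Bool} (h : ∃ i, d i = true) :
    d (pickTrue d) = true := by
  rw [pickTrue, dif_pos h]
  exact h.choose_spec

/-- The total loss on the validation sample `V` of the predictor that `R` outputs with seed and
training sample `q`. -/
def validationLoss (ℓ : Y → Y → ℝ) {M N : ℕ} (R : LearningRule X Y M)
    (q : R.Seed × (Fin M → X × Y)) (V : Fin N → X × Y) : ℝ :=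
  ∑ j, ℓ (R.predict q.1 q.2 (V j).1) (V j).2

/-- Some candidate whose validation loss is at most `t`; an arbitrary one if there is none. -/
noncomputable def selectCandidate (ℓ : Y → Y → ℝ) {M N k : ℕ} (R : LearningRule X Y M) (t : ℝ)
    (p : (Fin (k + 1) → R.Seed × (Fin M → X × Y)) × (Fin N → X × Y)) : Fin (k + 1) :=
  pickTrue fun i => decide (validationLoss ℓ R (p.1 i) p.2 ≤ t)

lemma measurable_validationLoss (hℓ : Measurable (Function.uncurry ℓ)) {M N : ℕ}
    (R : LearningRule X Y M) :
    Measurable fun p : (R.Seed × (Fin M → X × Y)) × (Fin N → X × Y) =>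
      validationLoss ℓ R p.1 p.2 := by
  refine Finset.measurable_sum _ fun j _ => ?_
  have h1 : Measurable fun p : (R.Seed × (Fin M → X × Y)) × (Fin N → X × Y) =>
      R.predict p.1.1 p.1.2 (p.2 j).1 :=
    R.measurable_predict.comp (f := fun p : (R.Seed × (Fin M → X × Y)) × (Fin N → X × Y) =>
      (p.1.1, p.1.2, (p.2 j).1)) (by fun_prop)
  exact hℓ.comp (h1.prodMk (by fun_prop : Measurable fun p :
    (R.Seed × (Fin M → X × Y)) × (Fin N → X × Y) => (p.2 j).2))

lemma measurable_selectCandidate (hℓ : Measurable (Function.uncurry ℓ)) {M N k : ℕ}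
    (R : LearningRule X Y M) (t : ℝ) :
    Measurable (selectCandidate (N := N) (k := k) ℓ R t) := by
  refine (Measurable.of_discrete (f := pickTrue (k := k))).comp (measurable_pi_iff.2 fun i => ?_)
  refine measurable_to_bool ?_
  have hm : Measurable fun p : (Fin (k + 1) → R.Seed × (Fin M → X × Y)) × (Fin N → X × Y) =>
      validationLoss ℓ R (p.1 i) p.2 :=
    (measurable_validationLoss hℓ R).comp (f := fun p :
      (Fin (k + 1) → R.Seed × (Fin M → X × Y)) × (Fin N → X × Y) => (p.1 i, p.2)) (by fun_prop)
  convert measurableSet_le hm (measurable_const (a := t)) using 1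
  ext p
  simp

lemma measurable_splitBlocks {Ω Z : Type*} [MeasurableSpace Ω] [MeasurableSpace Z]
    {k M N n : ℕ} (ι : (Fin k × Fin M) ⊕ Fin N → Fin n) :
    Measurable (splitBlocks (Ω := Ω) (Z := Z) ι) := by
  unfold splitBlocks
  fun_prop

/-- The rule that runs `k + 1` independent copies of `R` on disjoint blocks of the sample and
outputs one whose total loss on a further block is at most `t`, if there is one. -/
noncomputable def boostRule (hℓ : Measurable (Function.uncurry ℓ)) {k M N n : ℕ}
    (R : LearningRule X Y M) (t : ℝ) (ι : (Fin (k + 1) × Fin M) ⊕ Fin N → Fin n) :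
    LearningRule X Y n where
  Seed := Fin (k + 1) → R.Seed
  seedLaw := Measure.pi fun _ => R.seedLaw
  predict ω S x :=
    let q := (splitBlocks ι (ω, S)).1 (selectCandidate ℓ R t (splitBlocks ι (ω, S)))
    R.predict q.1 q.2 x
  measurable_predict := by
    have hs : Measurable fun p : (Fin (k + 1) → R.Seed) × (Fin n → X × Y) × X =>
        splitBlocks ι (p.1, p.2.1) :=
      (measurable_splitBlocks ι).comp (by fun_prop)
    refine Measurable.comp_countable_index
      (f := fun i (p : (Fin (k + 1) → R.Seed) × (Fin n → X × Y) × X) =>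
        R.predict ((splitBlocks ι (p.1, p.2.1)).1 i).1 ((splitBlocks ι (p.1, p.2.1)).1 i).2 p.2.2)
      ((measurable_selectCandidate hℓ R t).comp hs) fun i => ?_
    exact R.measurable_predict.comp (f := fun p :
      (Fin (k + 1) → R.Seed) × (Fin n → X × Y) × X =>
        (((splitBlocks ι (p.1, p.2.1)).1 i).1, ((splitBlocks ι (p.1, p.2.1)).1 i).2, p.2.2))
      (by fun_prop)

lemma measurable_predict_apply {n : ℕ} (R : LearningRule X Y n) (ω : R.Seed)
    (S : Fin n → X × Y) : Measurable (R.predict ω S) :=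
  R.measurable_predict.comp (f := fun x => (ω, S, x)) (by fun_prop)

lemma trueError_eq_ofReal_integral (hℓ : Measurable (Function.uncurry ℓ))
    (h01 : ∀ y y', 0 ≤ ℓ y y' ∧ ℓ y y' ≤ 1) (D : ProbabilityMeasure (X × Y)) {g : X → Y}
    (hg : Measurable g) :
    trueError ℓ D g = ENNReal.ofReal (∫ z, ℓ (g z.1) z.2 ∂(D : Measure (X × Y))) := by
  have hm : Measurable fun z : X × Y => ℓ (g z.1) z.2 :=
    hℓ.comp ((hg.comp measurable_fst).prodMk measurable_snd)
  refine (ofReal_integral_eq_lintegral_ofReal ?_ (ae_of_all _ fun z => (h01 _ _).1)).symm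
  exact Integrable.of_bound hm.aestronglyMeasurable 1
    (ae_of_all _ fun z => by rw [Real.norm_of_nonneg (h01 _ _).1]; exact (h01 _ _).2)

/-- The validation test with threshold `7 ε / 8` errs on a predictor of error above `ε` or at most
`3 ε / 4` with exponentially small probability. -/
lemma measure_validation_errs_le (hℓ : Measurable (Function.uncurry ℓ))
    (h01 : ∀ y y', 0 ≤ ℓ y y' ∧ ℓ y y' ≤ 1) {ε : ℝ} (hε : 0 < ε) {M N : ℕ}
    (R : LearningRule X Y M) (D : ProbabilityMeasure (X × Y)) (q : R.Seed × (Fin M → X × Y)) :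
    (Measure.pi fun _ : Fin N => (D : Measure (X × Y)))
      {V | (ENNReal.ofReal ε < trueError ℓ D (R.predict q.1 q.2) ∧
          validationLoss ℓ R q V ≤ 7 / 8 * ε * N) ∨
        (trueError ℓ D (R.predict q.1 q.2) ≤ ENNReal.ofReal (3 / 4 * ε) ∧
          7 / 8 * ε * N < validationLoss ℓ R q V)} ≤
      ENNReal.ofReal (Real.exp (-(ε * N / 256))) := by
  have hg := measurable_predict_apply R q.1 q.2
  have hm : Measurable fun z : X × Y => ℓ (R.predict q.1 q.2 z.1) z.2 :=
    hℓ.comp ((hg.comp measurable_fst).prodMk measurable_snd)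
  rw [trueError_eq_ofReal_integral hℓ h01 D hg]
  have hint0 : 0 ≤ ∫ z, ℓ (R.predict q.1 q.2 z.1) z.2 ∂(D : Measure (X × Y)) :=
    integral_nonneg fun z => (h01 _ _).1
  rcases le_or_gt (∫ z, ℓ (R.predict q.1 q.2 z.1) z.2 ∂(D : Measure (X × Y))) ε with hle | hlt
  · rcases le_or_gt (∫ z, ℓ (R.predict q.1 q.2 z.1) z.2 ∂(D : Measure (X × Y)))
      (3 / 4 * ε) with hle' | hlt'
    · refine (measure_mono fun V hV => ?_).trans
        (measure_lt_sum_of_mean_le hm (fun z => h01 _ _) hε.le hle' N)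
      rcases hV with ⟨h, -⟩ | ⟨-, h⟩
      · exact absurd (ENNReal.ofReal_le_ofReal hle) (not_le.2 h)
      · exact h
    · refine (measure_mono_null (fun V hV => ?_) measure_empty).trans_le zero_le
      rcases hV with ⟨h, -⟩ | ⟨h, -⟩
      · exact absurd (ENNReal.ofReal_le_ofReal hle) (not_le.2 h)
      · exact absurd ((ENNReal.ofReal_le_ofReal_iff (by positivity)).1 h) (not_le.2 hlt')
  · refine (measure_mono fun V hV => ?_).trans
      (measure_sum_le_of_lt_mean hm (fun z => h01 _ _) hlt.le N)
    rcases hV with ⟨-, h⟩ | ⟨h, -⟩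
    · exact h
    · have := (ENNReal.ofReal_le_ofReal_iff (by positivity)).1 h
      linarith

lemma prod_le_of_forall_slice_le {α β : Type*} [MeasurableSpace α] [MeasurableSpace β]
    (μ : Measure α) [IsProbabilityMeasure μ] (ν : Measure β) [SFinite ν] {s : Set (α × β)}
    (hs : MeasurableSet s) {c : ℝ≥0∞} (h : ∀ a, ν (Prod.mk a ⁻¹' s) ≤ c) :
    (μ.prod ν) s ≤ c := by
  rw [Measure.prod_apply hs]
  exact (lintegral_mono h).trans (by simp)

/-- Boosting fails only if all candidates have error above `3 ε / 4`, which by Markov's inequality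
has probability at most `2 / 3` for each, or if the validation test errs on one of them. -/
lemma failureProb_boostRule_le (hℓ : Measurable (Function.uncurry ℓ))
    (h01 : ∀ y y', 0 ≤ ℓ y y' ∧ ℓ y y' ≤ 1) {ε : ℝ} (hε : 0 < ε) {k M N n : ℕ}
    (R : LearningRule X Y M) {D : ProbabilityMeasure (X × Y)} (hD : D ∈ realizable ℓ H)
    (hR : expectedError ℓ R D ≤ ENNReal.ofReal (ε / 2))
    {ι : (Fin (k + 1) × Fin M) ⊕ Fin N → Fin n} (hι : Function.Injective ι) :
    failureProb ℓ H (boostRule hℓ R (7 / 8 * ε * N) ι) D ε ≤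
      ENNReal.ofReal ((2 / 3) ^ (k + 1) + (k + 1) * Real.exp (-(ε * N / 256))) := by
  rw [failureProb_of_realizable _ hD]
  set err : R.Seed × (Fin M → X × Y) → ℝ≥0∞ := fun q => trueError ℓ D (R.predict q.1 q.2) with herr
  have herrm : Measurable err := measurable_trueError_predict hℓ R D
  let Q : Measure (Fin (k + 1) → R.Seed × (Fin M → X × Y)) := Measure.pi fun _ => runLaw R D
  let P : Measure (Fin N → X × Y) := Measure.pi fun _ => (D : Measure (X × Y))
  -- `E₁`: all candidates have error above `3 ε / 4`; `E₂ i`: the test errs on candidate `i`.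
  let E₁ : Set ((Fin (k + 1) → R.Seed × (Fin M → X × Y)) × (Fin N → X × Y)) :=
    (Set.univ.pi fun _ => {q | ENNReal.ofReal (3 / 4 * ε) < err q}) ×ˢ Set.univ
  let E₂ (i : Fin (k + 1)) : Set ((Fin (k + 1) → R.Seed × (Fin M → X × Y)) × (Fin N → X × Y)) :=
    {p | (ENNReal.ofReal ε < err (p.1 i) ∧ validationLoss ℓ R (p.1 i) p.2 ≤ 7 / 8 * ε * N) ∨
      (err (p.1 i) ≤ ENNReal.ofReal (3 / 4 * ε) ∧
        7 / 8 * ε * N < validationLoss ℓ R (p.1 i) p.2)}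
  have hE₁ : (Q.prod P) E₁ ≤ ENNReal.ofReal ((2 / 3) ^ (k + 1)) := by
    have h23 : runLaw R D {q | ENNReal.ofReal (3 / 4 * ε) < err q} ≤ ENNReal.ofReal (2 / 3) := by
      refine (measure_lt_trueError_le hℓ R D (by positivity) hR).trans_eq ?_
      congr 1
      field_simp
      norm_num
    rw [Measure.prod_prod, Measure.pi_pi, measure_univ, mul_one, Finset.prod_const,
      Finset.card_univ, Fintype.card_fin, ENNReal.ofReal_pow (by norm_num)]
    gcongr
  have hE₂ (i : Fin (k + 1)) : (Q.prod P) (E₂ i) ≤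
      ENNReal.ofReal (Real.exp (-(ε * N / 256))) := by
    have hval : Measurable fun p : (Fin (k + 1) → R.Seed × (Fin M → X × Y)) × (Fin N → X × Y) =>
        validationLoss ℓ R (p.1 i) p.2 :=
      (measurable_validationLoss hℓ R).comp (f := fun p :
        (Fin (k + 1) → R.Seed × (Fin M → X × Y)) × (Fin N → X × Y) => (p.1 i, p.2))
        (by fun_prop)
    have herri : Measurable fun p : (Fin (k + 1) → R.Seed × (Fin M → X × Y)) ×
        (Fin N → X × Y) => err (p.1 i) := by fun_prop
    have hmeas : MeasurableSet (E₂ i) :=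
      ((measurableSet_lt measurable_const herri).inter
        (measurableSet_le hval measurable_const)).union
      ((measurableSet_le herri measurable_const).inter (measurableSet_lt measurable_const hval))
    exact prod_le_of_forall_slice_le Q P hmeas fun q =>
      measure_validation_errs_le hℓ h01 hε R D (q i)
  have hsub : {p : (Fin (k + 1) → R.Seed) × (Fin n → X × Y) | ENNReal.ofReal ε <
      trueError ℓ D ((boostRule hℓ R (7 / 8 * ε * N) ι).predict p.1 p.2)} ⊆
      splitBlocks ι ⁻¹' (E₁ ∪ ⋃ i, E₂ i) := by
    intro p hp
    by_contra hcon
    simp only [Set.mem_preimage, Set.mem_union, Set.mem_iUnion, not_or, not_exists] at hcon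
    obtain ⟨hc₁, hc₂⟩ := hcon
    set p' := splitBlocks ι p with hp'
    have hgood : ∃ i, err (p'.1 i) ≤ ENNReal.ofReal (3 / 4 * ε) := by
      by_contra! hall
      exact hc₁ ⟨fun i _ => hall i, Set.mem_univ _⟩
    obtain ⟨i, hi⟩ := hgood
    have hpass : validationLoss ℓ R (p'.1 i) p'.2 ≤ 7 / 8 * ε * N := by
      by_contra! hfail
      exact hc₂ i (Or.inr ⟨hi, hfail⟩)
    have hsel := pickTrue_spec (d := fun i => decide (validationLoss ℓ R (p'.1 i) p'.2 ≤
      7 / 8 * ε * N)) ⟨i, by simpa using hpass⟩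
    exact hc₂ _ (Or.inl ⟨hp, of_decide_eq_true hsel⟩)
  have hmp := measurePreserving_splitBlocks R.seedLaw (D : Measure (X × Y)) hι
  calc _ ≤ runLaw (boostRule hℓ R (7 / 8 * ε * N) ι) D (splitBlocks ι ⁻¹' (E₁ ∪ ⋃ i, E₂ i)) :=
        measure_mono hsub
    _ ≤ (Q.prod P) (E₁ ∪ ⋃ i, E₂ i) := hmp.measure_preimage_le _
    _ ≤ (Q.prod P) E₁ + ∑ i, (Q.prod P) (E₂ i) :=
        (measure_union_le _ _).trans (by gcongr; exact measure_iUnion_fintype_le _ _)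
    _ ≤ ENNReal.ofReal ((2 / 3) ^ (k + 1)) +
        ∑ _i : Fin (k + 1), ENNReal.ofReal (Real.exp (-(ε * N / 256))) := by
        gcongr with i
        exact hE₂ i
    _ = _ := by
        rw [ENNReal.ofReal_add (by positivity) (by positivity), ENNReal.ofReal_mul (by positivity),
          Finset.sum_const, Finset.card_univ, Fintype.card_fin, nsmul_eq_mul]
        congr 2
        rw [← ENNReal.ofReal_natCast]
        push_cast
        rfl

lemma mPAC_le_of_mExp_le (hℓ : Measurable (Function.uncurry ℓ))
    (h01 : ∀ y y', 0 ≤ ℓ y y' ∧ ℓ y y' ≤ 1) {ε δ : ℝ} (hε : 0 < ε) {k M N : ℕ}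
    (hM : mExp ℓ H (ε / 2) ≤ M)
    (hδ : (2 / 3) ^ (k + 1) + (k + 1) * Real.exp (-(ε * N / 256)) ≤ δ) :
    mPAC ℓ H ε δ ≤ ((k + 1) * M + N : ℕ) := by
  classical
  obtain ⟨A, hA⟩ := mExp_le_natCast_iff.1 hM
  have hex (n : ℕ) (hn : (k + 1) * M + N ≤ n) :
      ∃ ι : (Fin (k + 1) × Fin M) ⊕ Fin N → Fin n, Function.Injective ι := by
    obtain ⟨ι⟩ := Function.Embedding.nonempty_of_card_le
      (α := (Fin (k + 1) × Fin M) ⊕ Fin N) (β := Fin n) (by simpa using hn)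
    exact ⟨ι, ι.injective⟩
  refine mPAC_le_natCast_iff.2 ⟨fun n => if hn : (k + 1) * M + N ≤ n then
    boostRule hℓ (A M) (7 / 8 * ε * N) (hex n hn).choose else A n, fun n hn D hD => ?_⟩
  simp only [dif_pos (show (k + 1) * M + N ≤ n from hn)]
  exact (failureProb_boostRule_le hℓ h01 hε (A M) hD (hA M le_rfl D hD)
    (hex n hn).choose_spec).trans (ENNReal.ofReal_le_ofReal hδ)

/-- With `L = log (1 / min ε δ)`, take about `6 L` candidates and a validation block of size about
`1536 L / ε`. -/
lemma mPAC_le_mul_max (hℓ : Measurable (Function.uncurry ℓ))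
    (h01 : ∀ y y', 0 ≤ ℓ y y' ∧ ℓ y y' ≤ 1) {ε δ : ℝ} (hε : ε ∈ Set.Ioc (0 : ℝ) (1 / 2))
    (hδ : δ ∈ Set.Ioo (0 : ℝ) 1) :
    ((mPAC ℓ H ε δ : ℕ∞) : ℝ≥0∞) ≤ ENNReal.ofReal 1548 *
      max ((mExp ℓ H (ε / 2) : ℕ∞) : ℝ≥0∞) (ENNReal.ofReal (1 / ε)) *
        ENNReal.ofReal (Real.log (1 / min ε δ)) := by
  obtain ⟨hε0, hε1⟩ := hε
  set d := min ε δ with hd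
  have hd0 : 0 < d := lt_min hε0 hδ.1
  have hd1 : d ≤ 1 / 2 := (min_le_left _ _).trans hε1
  set L := Real.log (1 / d) with hL
  have hLd : Real.exp (-L) = d := by
    rw [hL, one_div, Real.log_inv, neg_neg, Real.exp_log hd0]
  have hL2 : 1 / 2 < L := by
    have h2 : Real.log 2 ≤ L := Real.log_le_log (by norm_num) (by
      rw [le_div_iff₀ hd0]; linarith)
    have := Real.log_two_gt_d9
    linarith
  rcases eq_or_ne (mExp ℓ H (ε / 2)) ⊤ with ht | ht
  · rw [ht, ENat.toENNReal_top, max_eq_left le_top, ENNReal.mul_top (by simp),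
      ENNReal.top_mul (by simpa using (by linarith : 0 < L))]
    exact le_top
  obtain ⟨M, hM⟩ := ENat.ne_top_iff_exists.1 ht
  obtain ⟨k, hk⟩ : ∃ k, ⌈6 * L⌉₊ = k + 1 :=
    ⟨⌈6 * L⌉₊ - 1, by have := Nat.ceil_pos.2 (by linarith : 0 < 6 * L); omega⟩
  set N := ⌈1536 * L / ε⌉₊ with hN
  -- In terms of `d = exp (-L) ≤ 1 / 2` the two parts of the failure probability are at most `d ^ 2`
  -- and `8 L * d ^ 6`, hence each at most `d / 2`.
  have hk1 : 6 * L ≤ k + 1 := by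
    have := Nat.le_ceil (6 * L); rw [hk] at this; exact_mod_cast this
  have hk2 : (k + 1 : ℝ) ≤ 8 * L := by
    have := (Nat.ceil_lt_add_one (by linarith : 0 ≤ 6 * L)).le
    rw [hk] at this; push_cast at this; linarith
  have hN1 : 6 * L ≤ ε * N / 256 := by
    have := Nat.le_ceil (1536 * L / ε)
    rw [div_le_iff₀ hε0] at this
    rw [le_div_iff₀ (by norm_num)]
    linarith
  have hεL : 1 ≤ 4 * (L / ε) := by
    rw [← mul_div_assoc, le_div_iff₀ hε0]; linarith
  have hN2 : (N : ℝ) ≤ 1540 * (L / ε) := by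
    have := (Nat.ceil_lt_add_one (by positivity : 0 ≤ 1536 * L / ε)).le
    rw [mul_div_assoc] at this
    rw [hN, mul_div_assoc]
    linarith
  have hpow1 : (2 / 3 : ℝ) ^ (k + 1) ≤ d / 2 := by
    have h23 : (2 / 3 : ℝ) ≤ Real.exp (-(1 / 3)) := by
      have := Real.add_one_le_exp (-(1 / 3) : ℝ); linarith
    calc (2 / 3 : ℝ) ^ (k + 1) ≤ Real.exp (-(1 / 3)) ^ (k + 1) := by gcongr
      _ = Real.exp (-((k + 1 : ℝ) / 3)) := by
          rw [← Real.exp_nat_mul]; congr 1; push_cast; ring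
      _ ≤ Real.exp ((2 : ℕ) * (-L)) := Real.exp_le_exp.2 (by push_cast; linarith)
      _ = d ^ 2 := by rw [Real.exp_nat_mul, hLd]
      _ ≤ d / 2 := by nlinarith
  have hpow2 : (k + 1 : ℝ) * Real.exp (-(ε * N / 256)) ≤ d / 2 := by
    have hexp : Real.exp (-(ε * N / 256)) ≤ d ^ 6 := by
      calc Real.exp (-(ε * N / 256)) ≤ Real.exp ((6 : ℕ) * (-L)) :=
            Real.exp_le_exp.2 (by push_cast; linarith)
        _ = d ^ 6 := by rw [Real.exp_nat_mul, hLd]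
    have hLd1 : L * d ≤ 1 := by
      have := Real.log_le_sub_one_of_pos (by positivity : 0 < 1 / d)
      calc L * d ≤ (1 / d) * d := by gcongr; linarith
        _ = 1 := by field_simp
    calc (k + 1 : ℝ) * Real.exp (-(ε * N / 256)) ≤ (8 * L) * d ^ 6 := by gcongr
      _ = 8 * (L * d) * d ^ 4 * d := by ring
      _ ≤ 8 * 1 * (1 / 2) ^ 4 * d := by gcongr
      _ = d / 2 := by ring
  have hPAC := mPAC_le_of_mExp_le hℓ h01 hε0 hM.ge (k := k) (N := N) (δ := δ)
    ((add_le_add hpow1 hpow2).trans (by rw [add_halves]; exact min_le_right _ _))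
  rw [← hM]
  refine (ENat.toENNReal_le.2 hPAC).trans ?_
  rw [ENat.toENNReal_coe, ENat.toENNReal_coe, ← ENNReal.ofReal_natCast, ← ENNReal.ofReal_natCast,
    ← ENNReal.ofReal_max, ← ENNReal.ofReal_mul (by norm_num), ← ENNReal.ofReal_mul (by positivity)]
  refine ENNReal.ofReal_le_ofReal ?_
  push_cast
  set m := max (M : ℝ) (1 / ε) with hm
  calc (k + 1 : ℝ) * M + N ≤ 8 * L * m + 1540 * (L / ε) := by
        gcongr
        exact le_max_left _ _
    _ = 8 * L * m + 1540 * L * (1 / ε) := by ring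
    _ ≤ 8 * L * m + 1540 * L * m := by
        gcongr
        exact le_max_right _ _
    _ = 1548 * m * L := by ring

/-! ### The bound for a fixed problem -/

/-- If a single example suffices for every error, then `mPAC ≤ 1` by Markov's inequality, and
`mPAC = 0` if no example is needed. Otherwise `mExp (ε / 2)` is at least of order `1 / ε`, so that
it dominates the maximum in the uniform bound. -/
lemma exists_mPAC_le_mul_mExp (hℓ : Measurable (Function.uncurry ℓ))
    (h01 : ∀ y y', 0 ≤ ℓ y y' ∧ ℓ y y' ≤ 1) (hH : ∀ h ∈ H, Measurable h) :
    ∃ K : ℝ, 0 < K ∧ ∃ ε₀ ∈ Set.Ioo (0 : ℝ) 1,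
      ∀ ε ∈ Set.Ioo (0 : ℝ) ε₀, ∀ δ ∈ Set.Ioo (0 : ℝ) 1,
        ((mPAC ℓ H ε δ : ℕ∞) : ℝ≥0∞) ≤
          ENNReal.ofReal K * ((mExp ℓ H (ε / 2) : ℕ∞) : ℝ≥0∞) *
            ENNReal.ofReal (Real.log (1 / min ε δ)) := by
  by_cases hone : ∀ η > 0, mExp ℓ H η ≤ 1
  · by_cases hzero : ∀ η > 0, mExp ℓ H η = 0
    · refine ⟨1, one_pos, 1 / 2, by norm_num, fun ε hε δ hδ => ?_⟩
      have : mPAC ℓ H ε δ = 0 := le_antisymm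
        ((mPAC_le_mExp_mul hℓ hε.1 δ).trans (hzero _ (mul_pos hε.1 hδ.1)).le) zero_le
      simp [this]
    · push Not at hzero
      obtain ⟨η, hη, hne⟩ := hzero
      refine ⟨2, two_pos, min (2 * η) (1 / 2), ⟨by positivity, by
        exact (min_le_right _ _).trans_lt (by norm_num)⟩, fun ε hε δ hδ => ?_⟩
      have hε1 : ε < 2 * η := hε.2.trans_le (min_le_left _ _)
      have hε2 : ε < 1 / 2 := hε.2.trans_le (min_le_right _ _)
      have hM : 1 ≤ mExp ℓ H (ε / 2) :=
        (Order.one_le_iff_pos.2 (pos_iff_ne_zero.2 hne)).trans (mExp_antitone (by linarith))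
      have hP : mPAC ℓ H ε δ ≤ 1 :=
        (mPAC_le_mExp_mul hℓ hε.1 δ).trans (hone _ (mul_pos hε.1 hδ.1))
      have hd0 : 0 < min ε δ := lt_min hε.1 hδ.1
      have hlog : 1 ≤ 2 * Real.log (1 / min ε δ) := by
        have h2 : Real.log 2 ≤ Real.log (1 / min ε δ) := Real.log_le_log (by norm_num) (by
          rw [le_div_iff₀ hd0]; linarith [min_le_left ε δ])
        have := Real.log_two_gt_d9
        linarith
      calc ((mPAC ℓ H ε δ : ℕ∞) : ℝ≥0∞) ≤ 1 := by exact_mod_cast ENat.toENNReal_le.2 hP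
        _ ≤ ENNReal.ofReal (2 * Real.log (1 / min ε δ)) := by simpa using hlog
        _ = ENNReal.ofReal 2 * 1 * ENNReal.ofReal (Real.log (1 / min ε δ)) := by
            rw [mul_one, ENNReal.ofReal_mul zero_le_two]
        _ ≤ _ := by
            gcongr
            exact_mod_cast ENat.toENNReal_le.2 hM
  · push Not at hone
    obtain ⟨η, hη, hgt⟩ := hone
    set c := max 1 (Real.exp 1 / η) with hc
    have hc1 : 1 ≤ c := le_max_left _ _
    refine ⟨1548 * c, by positivity, min (2 * η) (1 / 2), ⟨by positivity, by
      exact (min_le_right _ _).trans_lt (by norm_num)⟩, fun ε hε δ hδ => ?_⟩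
    have hε0 := hε.1
    have hε1 : ε < 2 * η := hε.2.trans_le (min_le_left _ _)
    have hε2 : ε < 1 / 2 := hε.2.trans_le (min_le_right _ _)
    refine (mPAC_le_mul_max hℓ h01 ⟨hε0, hε2.le⟩ hδ).trans ?_
    rw [ENNReal.ofReal_mul (by norm_num), mul_assoc (ENNReal.ofReal 1548) (ENNReal.ofReal c)]
    gcongr ENNReal.ofReal 1548 * ?_ * _
    refine max_le (le_mul_of_one_le_left zero_le (by simpa using hc1)) ?_
    rcases eq_or_ne (mExp ℓ H (ε / 2)) ⊤ with ht | ht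
    · rw [ht, ENat.toENNReal_top, ENNReal.mul_top (by simpa using by linarith)]
      exact le_top
    obtain ⟨M, hM⟩ := ENat.ne_top_iff_exists.1 ht
    have hM1 : 1 ≤ M := by
      have h : 1 < mExp ℓ H (ε / 2) := hgt.trans_le (mExp_antitone (by linarith))
      rw [← hM] at h
      exact_mod_cast h.le
    have hM1' : (1 : ℝ) ≤ M := by exact_mod_cast hM1
    have hlow := div_lt_of_mExp_le hℓ (fun y y' => (h01 y y').1) hH hgt
      (by positivity : 0 ≤ ε / 2) hM.ge
    rw [← hM, ENat.toENNReal_coe, ← ENNReal.ofReal_natCast, ← ENNReal.ofReal_mul (by positivity)]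
    refine ENNReal.ofReal_le_ofReal ?_
    have hexp := Real.exp_pos 1
    calc 1 / ε ≤ Real.exp 1 / η * M := by
          rw [div_mul_eq_mul_div, div_le_div_iff₀ hε0 hη]
          calc 1 * η ≤ Real.exp 1 * (M + 1) * (ε / 2) := by linarith
            _ ≤ Real.exp 1 * (M + M) * (ε / 2) := by gcongr
            _ = Real.exp 1 * M * ε := by ring
      _ ≤ c * M := by gcongr; exact le_max_right _ _

end

theorem mainTheorem6 :
    (∃ C : ℝ, 0 < C ∧
      ∀ (X : Type u) (Y : Type v) [MeasurableSpace X] [MeasurableSpace Y]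
        (ℓ : Y → Y → ℝ) (H : Set (X → Y)),
        Measurable (Function.uncurry ℓ) →
        (∀ y y', 0 ≤ ℓ y y' ∧ ℓ y y' ≤ 1) →
        (∀ h ∈ H, Measurable h) →
        -- expected error versus PAC
        (∀ ε ∈ Set.Ioo (0 : ℝ) 1, ∀ δ ∈ Set.Ioo (0 : ℝ) 1,
          mExp ℓ H (ε + δ) ≤ mPAC ℓ H ε δ) ∧
        -- PAC versus expected error, as `ε → 0` for the given problem
        (∃ K : ℝ, 0 < K ∧ ∃ ε₀ ∈ Set.Ioo (0 : ℝ) 1,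
          ∀ ε ∈ Set.Ioo (0 : ℝ) ε₀, ∀ δ ∈ Set.Ioo (0 : ℝ) 1,
            ((mPAC ℓ H ε δ : ℕ∞) : ℝ≥0∞) ≤
              ENNReal.ofReal K * ((mExp ℓ H (ε / 2) : ℕ∞) : ℝ≥0∞) *
                ENNReal.ofReal (Real.log (1 / min ε δ))) ∧
        -- PAC versus expected error, with the absolute constant `C`
        (∀ ε ∈ Set.Ioc (0 : ℝ) (1 / 2), ∀ δ ∈ Set.Ioo (0 : ℝ) 1,
            ((mPAC ℓ H ε δ : ℕ∞) : ℝ≥0∞) ≤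
              ENNReal.ofReal C *
                max ((mExp ℓ H (ε / 2) : ℕ∞) : ℝ≥0∞) (ENNReal.ofReal (1 / ε)) *
                ENNReal.ofReal (Real.log (1 / min ε δ))) ∧
        -- expected error versus transductive error
        ((∀ y y', ℓ y y' = 0 → y = y') →
          ∀ ε ∈ Set.Ioo (0 : ℝ) 1, mExp ℓ H ε ≤ mTrans ℓ H ε) ∧
        ((∀ y, ℓ y y = 0) →
          ∀ ε ∈ Set.Ioo (0 : ℝ) 1, mTrans ℓ H ε ≤ mExp ℓ H (ε / Real.exp 1) + 1)) ∧
    -- coupon collector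
    (∀ n : ℕ, 1 ≤ n → ∃ m : ℕ,
      ENNReal.ofReal (1 / Real.exp 1) ≤
        Measure.pi (fun _ : Fin m => ProbabilityTheory.uniformOn (Set.univ : Set (Fin n)))
          {f | (Set.range f).ncard = n - 1}) := by
  refine ⟨⟨1548, by norm_num, fun X Y _ _ ℓ H hℓ h01 hH => ⟨fun ε hε δ hδ =>
    mExp_add_le_mPAC hℓ (fun y y' => (h01 y y').2) hε.1.le hδ.1.le,
    exists_mPAC_le_mul_mExp hℓ h01 hH, fun ε hε δ hδ => mPAC_le_mul_max hℓ h01 hε hδ,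
    fun hdef ε _ => mExp_le_mTrans hℓ (fun y y' => (h01 y y').1) hdef hH ε,
    fun hrefl ε hε => mTrans_le_mExp_add_one hℓ hrefl hH hε.1⟩⟩, exists_coupon_draws⟩
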